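/- Let $n\ge 0$ and let $\mathrm{Mat}(\mathbb C,n)$ be the space of complex $n\times n$ matrices, regarded as a real vector space of dimension $2n^2$. A partition of a natural number $m$ is a tuple $(s_1,\dots,s_k)$ of integers with $s_1\ge\dots\ge s_k\ge 1$ and $s_1+\dots+s_k=m$. Let $\Xi_n$ be the set of all $\xi=(p;p_1,\dots,p_k)$, where $p=(s_1,\dots,s_k)$ is a partition of $n$ and $p_i$ is a partition of $s_i$ for every $i$. For $\xi\in\Xi_n$ and $x=(x_1,\dots,x_k)\in\mathbb R^k$, let $B_\xi(x)\in\mathrm{Mat}(\mathbb C,n)$ be the block diagonal matrix with $k$ consecutive diagonal blocks, the $j$-th of which has size $s_j$ and is itself block diagonal, with upper triangular Jordan blocks of eigenvalue $x_j\sqrt{-1}$ and of the sizes listed in $p_j$. Put $$\mathcal O_\xi=\{A^{-1}B_\xi(x)A \mid A\in \mathrm{GL}(n,\mathbb C),\ x\in\mathbb R^k,\ x_i\neq x_j\text{ for } i\ne j\}.$$ **Theorem.** The set $\Xi_n$ is finite, and the set of matrices in $\mathrm{Mat}(\mathbb C,n)$ all of whose eigenvalues lie on the imaginary axis ($0$ included)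 equals $\bigcup_{\xi\in\Xi_n}\mathcal O_\xi$. Any two of the sets $\mathcal O_\xi$ are either equal or disjoint. Every $\mathcal O_\xi$ is non-empty, invariant under conjugation by $\mathrm{GL}(n,\mathbb C)$, and a smooth embedded submanifold of $\mathrm{Mat}(\mathbb C,n)$ of some real dimension at most $2n^2-n$. There is exactly one $\xi\in\Xi_n$ for which $\mathcal O_\xi$ has real dimension $2n^2-n$, and for this $\xi$ the set $\mathcal O_\xi$ consists of exactly those matrices that have $n$ distinct eigenvalues, all on the imaginary axis. -/

import Mathlib

open scoped Matrix.Norms.Operator ContDiff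

/-- A partition `s₁ ≥ s₂ ≥ ⋯ ≥ s_k ≥ 1` of `n`, written as a decreasing tuple. -/
structure TuplePartition (n : ℕ) where
  /-- the number `k` of parts -/
  length : ℕ
  /-- the parts `s₁, …, s_k` -/
  part : Fin length → ℕ
  antitone_part : Antitone part
  one_le_part : ∀ i, 1 ≤ part i
  sum_part : ∑ i, part i = n

/-- A refined partition `ξ = (p; p₁, …, p_k)` of `n`: a partition `p = (s₁, …, s_k)` of `n`
together with a partition `p_i` of every part `s_i`. -/
structure RefinedPartition (n : ℕ) where
  base : TuplePartition n
  sub : ∀ i : Fin base.length, TuplePartition (base.part i)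

/-- The parameter set of `ξ`: real `k`-tuples with pairwise distinct entries, where `k` is the
number of parts of the underlying partition of `n`. -/
def RefinedPartition.params {n : ℕ} (ξ : RefinedPartition n) : Set (Fin ξ.base.length → ℝ) :=
  {x | Function.Injective x}

/-- The `s × s` Jordan block with eigenvalue `z` (ones on the superdiagonal). -/
def jordanBlockMatrix (s : ℕ) (z : ℂ) : Matrix (Fin s) (Fin s) ℂ :=
  Matrix.of fun i j => if i = j then z else if (i : ℕ) + 1 = (j : ℕ) then 1 else 0

/-- The `n × n` block diagonal matrix whose consecutive diagonal blocks have the sizes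
`s₁, …, s_k` of a partition of `n`. -/
def TuplePartition.blockMatrix {n : ℕ} (p : TuplePartition n)
    (M : ∀ i : Fin p.length, Matrix (Fin (p.part i)) (Fin (p.part i)) ℂ) :
    Matrix (Fin n) (Fin n) ℂ :=
  Matrix.reindex (finSigmaFinEquiv.trans (finCongr p.sum_part))
    (finSigmaFinEquiv.trans (finCongr p.sum_part)) (Matrix.blockDiagonal' M)

/-- The Jordan matrix with the single eigenvalue `z` and the block sizes given by `p`. -/
def TuplePartition.jordanMatrix {n : ℕ} (p : TuplePartition n) (z : ℂ) :
    Matrix (Fin n) (Fin n) ℂ :=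
  p.blockMatrix fun i => jordanBlockMatrix (p.part i) z

/-- The Jordan matrix `B_ξ(x)`: the `i`-th diagonal block has size `s_i`, the single eigenvalue
`x_i * I`, and Jordan blocks whose sizes are given by `p_i`. -/
noncomputable def RefinedPartition.jordanMatrix {n : ℕ} (ξ : RefinedPartition n)
    (x : Fin ξ.base.length → ℝ) : Matrix (Fin n) (Fin n) ℂ :=
  ξ.base.blockMatrix fun i => (ξ.sub i).jordanMatrix ((x i : ℂ) * Complex.I)

/-- The set `O_ξ` of all complex matrices that are conjugate to `B_ξ(x)` for some `x` with pairwise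
distinct entries. -/
def RefinedPartition.stratum {n : ℕ} (ξ : RefinedPartition n) : Set (Matrix (Fin n) (Fin n) ℂ) :=
  {X | ∃ A : GL (Fin n) ℂ, ∃ x ∈ ξ.params,
    X = ((A⁻¹ : GL (Fin n) ℂ) : Matrix (Fin n) (Fin n) ℂ) * ξ.jordanMatrix x *
      (A : Matrix (Fin n) (Fin n) ℂ)}

/-- All eigenvalues of the matrix lie on the imaginary axis (zero included). -/
def HasImaginarySpectrum {n : ℕ} (X : Matrix (Fin n) (Fin n) ℂ) : Prop :=
  ∀ z ∈ spectrum ℂ X, z.re = 0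

/-- A set of matrices that is mapped to itself by conjugation with every invertible matrix. -/
def IsConjugacyInvariant {n : ℕ} (S : Set (Matrix (Fin n) (Fin n) ℂ)) : Prop :=
  ∀ A : GL (Fin n) ℂ, ∀ X ∈ S,
    ((A⁻¹ : GL (Fin n) ℂ) : Matrix (Fin n) (Fin n) ℂ) * X * (A : Matrix (Fin n) (Fin n) ℂ) ∈ S

/-- `S` is a smooth embedded submanifold, of real dimension `d` everywhere, of the
finite-dimensional real vector space `E`: around every point of `S` there is a smooth chart of `E`
(a diffeomorphism between open subsets of `E`) that maps `S` onto a `d`-dimensional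
linear subspace, within the domain and the range of the chart. -/
def IsEmbeddedSubmanifold {E : Type*} [NormedAddCommGroup E] [NormedSpace ℝ E]
    (S : Set E) (d : ℕ) : Prop :=
  ∀ x ∈ S, ∃ (φ : OpenPartialHomeomorph E E) (L : Submodule ℝ E),
    x ∈ φ.source ∧ ContDiffOn ℝ ∞ φ φ.source ∧ ContDiffOn ℝ ∞ φ.symm φ.target ∧
    φ '' (S ∩ φ.source) = (L : Set E) ∩ φ.target ∧ Module.finrank ℝ L = d

/-! Similarity of Jordan matrices is decided by the dimensions of the kernels of `(X - w)^m`. For a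
partition these dimensions are `∑ min (s_a, m)`, and their increments in `m` count the parts larger
than `m`, so they recover the partition. Hence two strata that meet have the same Jordan types up to
relabelling of the eigenvalues, and then they coincide. That the strata exhaust the matrices with
imaginary spectrum is the Jordan normal form, obtained from the structure theorem for torsion
`ℂ[X]`-modules by grouping the blocks with a common eigenvalue.

For smoothness, the key fact is that `B_ξ(x)` has the same centralizer for all injective `x`. Let
`N` be a complement of the centralizer of `C x₀`, a conjugate of `B_ξ(x₀)`. The map `(a, t) ↦ (1 +
a) * C (x₀ + t) * (1 + a)⁻¹` on `N × ℝ^k` is an immersion at `0`: the trace form against the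
spectral projections separates the directions `t` from the commutators. That it covers all of the
stratum near `C x₀`, which makes the submanifold embedded, needs two inputs. First, nearby points of
the stratum have nearby parameters up to a permutation preserving the Jordan types
(`exists_perm_of_tendsto`, by compactness and semicontinuity of nullity). Second, because
centralizers keep their dimension, two nearby conjugate matrices are conjugate by a matrix near `1`
(`exists_mem_intertwiner_of_near`).

The dimension is thus `k + 2 * (n ^ 2 - c)`, with `c` the complex dimension of the centralizer.
Since `k ≤ n ≤ c`, it is at most `2 * n ^ 2 - n`. If `k = n`, all parts are `1` and `c = n`, so
equality holds; if `k < n`, the inequality is strict. The dimension of a non-empty submanifold is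
unique, so exactly one `ξ` is generic. -/

open Matrix Filter Topology

/-! ### Embedded submanifolds: charts from immersions, uniqueness of the dimension -/

section EmbeddedSubmanifold

variable {V E : Type*} [NormedAddCommGroup V] [NormedSpace ℝ V] [NormedAddCommGroup E]
  [NormedSpace ℝ E]

/-- A set that is locally the image of an immersion has adapted charts. -/
theorem exists_chart_of_immersion [FiniteDimensional ℝ V] [FiniteDimensional ℝ E]
    {S : Set E} {x : E} {G : V → E} {G' : V →L[ℝ] E} (hG : ContDiffAt ℝ ω G 0)
    (hG' : HasFDerivAt G G' 0) (hinj : Function.Injective G') (h0 : G 0 = x)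
    (hS : ∀ᶠ v in 𝓝 0, G v ∈ S) (hloc : ∀ W ∈ 𝓝 (0 : V), ∀ᶠ y in 𝓝[S] x, y ∈ G '' W) :
    ∃ (φ : OpenPartialHomeomorph E E) (L : Submodule ℝ E),
      x ∈ φ.source ∧ ContDiffOn ℝ ∞ φ φ.source ∧ ContDiffOn ℝ ∞ φ.symm φ.target ∧
      φ '' (S ∩ φ.source) = (L : Set E) ∩ φ.target ∧
      Module.finrank ℝ L = Module.finrank ℝ V := by
  have : CompleteSpace E := FiniteDimensional.complete ℝ E
  obtain ⟨r₀, hr₀⟩ := LinearMap.exists_leftInverse_of_injective (G' : V →ₗ[ℝ] E)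
    (LinearMap.ker_eq_bot.2 hinj)
  set r : E →L[ℝ] V := LinearMap.toContinuousLinearMap r₀ with hr
  have hrG (v : V) : r (G' v) = v := LinearMap.congr_fun hr₀ v
  -- Extends `G` to a local diffeomorphism of `E`: along the range of `G'` it is `G`, and the part
  -- of `e` killed by `r` is added. Its derivative at `0` is `G' r + (id - G' r) = id`.
  set F : E → E := fun e => G (r e) + (e - G' (r e)) with hF
  have hF0 : F 0 = x := by simp [hF, h0]
  have hFG (v : V) : F (G' v) = G v := by simp [hF, hrG]
  have hG0 : ContDiffAt ℝ ω G (r 0) := by simpa using hG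
  have hFω : ContDiffAt ℝ ω F 0 :=
    (hG0.comp (0 : E) r.contDiff.contDiffAt).add
      (contDiffAt_id.sub (G'.contDiff.contDiffAt.comp (0 : E) r.contDiff.contDiffAt))
  have hG'0 : HasFDerivAt G G' (r 0) := by simpa using hG'
  have hF' : HasFDerivAt F ((ContinuousLinearEquiv.refl ℝ E : E ≃L[ℝ] E) : E →L[ℝ] E) 0 := by
    have h := (hG'0.comp (0 : E) r.hasFDerivAt).add
      ((hasFDerivAt_id (𝕜 := ℝ) (0 : E)).sub (G'.hasFDerivAt.comp (0 : E) r.hasFDerivAt))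
    refine HasFDerivAt.congr_fderiv (f := F) h ?_
    ext v
    simp
  have hω : (ω : WithTop ℕ∞) ≠ 0 := by simp
  set e := hFω.toOpenPartialHomeomorph F hF' hω with he
  have heF : (e : E → E) = F := rfl
  have h0e : (0 : E) ∈ e.source := hFω.mem_toOpenPartialHomeomorph_source hF' hω
  have hxe : x ∈ e.target := hF0 ▸ hFω.image_mem_toOpenPartialHomeomorph_target hF' hω
  have hex : e.symm x = 0 := by
    rw [← hF0, ← heF, e.left_inv h0e]
  have hsymm : ContDiffAt ℝ ω e.symm x := by
    apply e.contDiffAt_symm hxe (f₀' := ContinuousLinearEquiv.refl ℝ E)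
    · rw [hex]; exact hF'
    · rw [hex]; exact hFω
  -- Here analyticity matters: being `ContDiffAt` of order `ω` is an open condition, unlike order
  -- `∞`.
  have hW : ∀ᶠ w in 𝓝 (0 : E), ContDiffAt ℝ ω F w ∧ G (r w) ∈ S := by
    refine (hFω.eventually (by simp)).and ?_
    have : Tendsto r (𝓝 0) (𝓝 0) := by simpa using r.continuous.tendsto 0
    exact this.eventually hS
  obtain ⟨W₀, hW₀, hW₀o, h0W₀⟩ := eventually_nhds_iff.1 hW
  have hpre : G' ⁻¹' (W₀ ∩ e.source) ∈ 𝓝 (0 : V) := by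
    apply G'.continuous.continuousAt.preimage_mem_nhds
    rw [map_zero]
    exact (hW₀o.inter e.open_source).mem_nhds ⟨h0W₀, h0e⟩
  have hU : ∀ᶠ y in 𝓝 x, ContDiffAt ℝ ω e.symm y ∧
      (y ∈ S → y ∈ G '' (G' ⁻¹' (W₀ ∩ e.source))) :=
    (hsymm.eventually (by simp)).and (eventually_nhdsWithin_iff.1 (hloc _ hpre))
  obtain ⟨U₀, hU₀, hU₀o, hxU₀⟩ := eventually_nhds_iff.1 hU
  refine ⟨(e.restrOpen W₀ hW₀o).symm.restrOpen U₀ hU₀o,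
    LinearMap.range (G' : V →ₗ[ℝ] E), ?_, ?_, ?_, ?_, ?_⟩
  · simp [hxe, hex, h0W₀, hxU₀]
  · intro y hy
    exact ((hU₀ y hy.2).1.of_le (by simp)).contDiffWithinAt
  · intro w hw
    have hw' : w ∈ W₀ := by
      have := hw
      simp at this
      tauto
    exact ((hW₀ w hw').1.of_le (by simp)).contDiffWithinAt
  · ext w
    constructor
    · rintro ⟨y, ⟨hyS, hy⟩, rfl⟩
      refine ⟨?_, OpenPartialHomeomorph.map_source _ hy⟩
      obtain ⟨v, hv, rfl⟩ := (hU₀ y hy.2).2 hyS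
      refine ⟨v, ?_⟩
      change G' v = e.symm (G v)
      rw [← hFG, ← heF, e.left_inv hv.2]
    · rintro ⟨⟨v, rfl⟩, hw⟩
      refine ⟨_, ⟨?_, OpenPartialHomeomorph.map_target _ hw⟩,
        OpenPartialHomeomorph.right_inv _ hw⟩
      have hw' : G' v ∈ W₀ := by
        have := hw
        simp at this
        tauto
      change F (G' v) ∈ S
      rw [hFG]
      simpa [hrG] using (hW₀ _ hw').2
  · exact LinearMap.finrank_range_of_inj hinj

/-- The transition map `f` between the two charts is locally invertible, so its derivative is
injective, and it carries `L` into `L'` near `φ x`. Hence the derivative embeds `L` into `L'`. -/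
theorem IsEmbeddedSubmanifold.le_of_nonempty [FiniteDimensional ℝ E] {S : Set E} {d d' : ℕ}
    (h : IsEmbeddedSubmanifold S d) (h' : IsEmbeddedSubmanifold S d') (hS : S.Nonempty) :
    d ≤ d' := by
  obtain ⟨x, hx⟩ := hS
  obtain ⟨φ, L, hxφ, hφ, hφs, himg, rfl⟩ := h x hx
  obtain ⟨ψ, L', hxψ, hψ, hψs, himg', rfl⟩ := h' x hx
  obtain ⟨f, hf⟩ : ∃ f : E → E, f = fun w => ψ (φ.symm w) := ⟨_, rfl⟩
  obtain ⟨g, hg⟩ : ∃ g : E → E, g = fun w => φ (ψ.symm w) := ⟨_, rfl⟩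
  have hfd : DifferentiableAt ℝ f (φ x) := by
    have h1 : DifferentiableAt ℝ ψ (φ.symm (φ x)) := by
      rw [φ.left_inv hxφ]
      exact (hψ.contDiffAt (ψ.open_source.mem_nhds hxψ)).differentiableAt (by simp)
    rw [hf]
    exact h1.comp (φ x) ((hφs.contDiffAt (φ.open_target.mem_nhds
      (φ.map_source hxφ))).differentiableAt (by simp))
  have hgd : DifferentiableAt ℝ g (f (φ x)) := by
    have h1 : f (φ x) = ψ x := by simp [hf, φ.left_inv hxφ]
    rw [h1]
    have h2 : DifferentiableAt ℝ φ (ψ.symm (ψ x)) := by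
      rw [ψ.left_inv hxψ]
      exact (hφ.contDiffAt (φ.open_source.mem_nhds hxφ)).differentiableAt (by simp)
    rw [hg]
    exact h2.comp (ψ x) ((hψs.contDiffAt (ψ.open_target.mem_nhds
      (ψ.map_source hxψ))).differentiableAt (by simp))
  have hev : ∀ᶠ w in 𝓝 (φ x), w ∈ φ.target ∧ φ.symm w ∈ ψ.source := by
    refine (φ.open_target.eventually_mem (φ.map_source hxφ)).and ?_
    have := (φ.continuousAt_symm (φ.map_source hxφ))
    rw [ContinuousAt, φ.left_inv hxφ] at this
    exact this.eventually (ψ.open_source.eventually_mem hxψ)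
  have hgf : g ∘ f =ᶠ[𝓝 (φ x)] id := by
    filter_upwards [hev] with w hw
    simp [hf, hg, ψ.left_inv hw.2, φ.right_inv hw.1]
  have hcomp : (fderiv ℝ g (f (φ x))).comp (fderiv ℝ f (φ x)) = ContinuousLinearMap.id ℝ E := by
    rw [← fderiv_comp _ hgd hfd, hgf.fderiv_eq, fderiv_id]
  have hφx : φ x ∈ L := (himg.subset ⟨x, ⟨hx, hxφ⟩, rfl⟩).1
  -- The derivative along `v` is a limit of difference quotients lying in `L'`, which is closed.
  have hmaps (v : L) : fderiv ℝ f (φ x) v ∈ L' := by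
    have hline : HasDerivAt (fun t : ℝ => φ x + t • (v : E)) (v : E) 0 := by
      simpa using ((hasDerivAt_id (0 : ℝ)).smul_const (v : E)).const_add (φ x)
    have hfl : HasDerivAt (fun t : ℝ => f (φ x + t • (v : E))) (fderiv ℝ f (φ x) v) 0 := by
      have hfd' : HasFDerivAt f (fderiv ℝ f (φ x)) (φ x + (0 : ℝ) • (v : E)) := by
        simpa using hfd.hasFDerivAt
      exact hfd'.comp_hasDerivAt (0 : ℝ) hline
    have htends : Tendsto (fun t : ℝ => φ x + t • (v : E)) (𝓝 0) (𝓝 (φ x)) := by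
      simpa using hline.continuousAt.tendsto
    have hmem : ∀ᶠ t in 𝓝 (0 : ℝ), f (φ x + t • (v : E)) ∈ L' := by
      filter_upwards [htends.eventually hev] with t ht
      have h1 : φ x + t • (v : E) ∈ (L : Set E) ∩ φ.target :=
        ⟨L.add_mem hφx (L.smul_mem t v.2), ht.1⟩
      rw [← himg] at h1
      obtain ⟨y, ⟨hyS, hy⟩, hyw⟩ := h1
      have h2 : φ.symm (φ x + t • (v : E)) = y := by rw [← hyw, φ.left_inv hy]
      have h3 : y ∈ ψ.source := h2 ▸ ht.2
      have h4 := (himg'.subset ⟨y, ⟨hyS, h3⟩, rfl⟩).1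
      simpa [hf, h2] using h4
    have hslope := hfl.tendsto_slope_zero
    refine L'.closed_of_finiteDimensional.mem_of_tendsto hslope ?_
    have h0 : f (φ x) ∈ L' := by simpa using hmem.self_of_nhds
    have hmem' : ∀ᶠ t in 𝓝[≠] (0 : ℝ), f (φ x + t • (v : E)) ∈ L' :=
      hmem.filter_mono nhdsWithin_le_nhds
    filter_upwards [hmem'] with t ht
    simpa using L'.smul_mem t⁻¹ (L'.sub_mem ht h0)
  let T : L →ₗ[ℝ] L' := LinearMap.restrict (fderiv ℝ f (φ x) : E →ₗ[ℝ] E) fun v hv => hmaps ⟨v, hv⟩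
  refine LinearMap.finrank_le_finrank_of_injective (f := T) fun u v huv => ?_
  have h1 : fderiv ℝ f (φ x) u = fderiv ℝ f (φ x) v := congrArg Subtype.val huv
  have h2 := congrArg (fderiv ℝ g (f (φ x))) h1
  have h3 (w : E) : fderiv ℝ g (f (φ x)) (fderiv ℝ f (φ x) w) = w :=
    DFunLike.congr_fun hcomp w
  rw [h3, h3] at h2
  exact Subtype.ext h2

theorem IsEmbeddedSubmanifold.dim_unique [FiniteDimensional ℝ E] {S : Set E} {d d' : ℕ}
    (h : IsEmbeddedSubmanifold S d) (h' : IsEmbeddedSubmanifold S d') (hS : S.Nonempty) :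
    d = d' :=
  (h.le_of_nonempty h' hS).antisymm (h'.le_of_nonempty h hS)

end EmbeddedSubmanifold

/-! ### Conjugation: local slices and charts -/

section ConjugationOrbits

variable {ι κ : Type*} [Fintype ι] [DecidableEq ι] [Fintype κ]

/-- The matrices `A` with `X * A = A * Y`. -/
def intertwiner (X Y : Matrix ι ι ℂ) : Submodule ℂ (Matrix ι ι ℂ) where
  carrier := {A | X * A = A * Y}
  add_mem' {A B} hA hB := by
    simp only [Set.mem_ofPred_eq] at hA hB ⊢
    rw [mul_add, add_mul, hA, hB]
  zero_mem' := by simp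
  smul_mem' c A hA := by
    simp only [Set.mem_ofPred_eq] at hA ⊢
    rw [Matrix.mul_smul, Matrix.smul_mul, hA]

@[simp]
theorem mem_intertwiner {X Y A : Matrix ι ι ℂ} : A ∈ intertwiner X Y ↔ X * A = A * Y :=
  Iff.rfl

/-- Left multiplication by `g` carries the centralizer of `Y` onto the intertwiners from `Y` to its
conjugate. -/
theorem finrank_intertwiner_conj (g : (Matrix ι ι ℂ)ˣ) (Y : Matrix ι ι ℂ) :
    Module.finrank ℂ (intertwiner Y Y) =
      Module.finrank ℂ (intertwiner (g.val * Y * (g⁻¹).val) Y) := by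
  have hinj : Function.Injective (LinearMap.mulLeft ℂ (g : Matrix ι ι ℂ)) := fun A B h => by
    simpa using h
  rw [(Submodule.equivMapOfInjective _ hinj (intertwiner Y Y)).finrank_eq]
  suffices h : (intertwiner Y Y).map (LinearMap.mulLeft ℂ g.val) =
      intertwiner (g.val * Y * (g⁻¹).val) Y by rw [h]
  ext A
  simp only [Submodule.mem_map, mem_intertwiner, LinearMap.mulLeft_apply]
  constructor
  · rintro ⟨B, hB, rfl⟩
    simp [mul_assoc, hB]
  · intro h
    refine ⟨(g⁻¹).val * A, ?_, by simp⟩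
    rw [mul_assoc (g⁻¹).val A Y, ← h]
    simp [mul_assoc]

/-- The commutator with `X₀` is injective on `N`, hence bounded below there, and so is `a ↦ X * a -
a * Y` for `X`, `Y` near `X₀`. The intertwiners therefore meet `N` trivially, and the rank
hypothesis makes them a complement of `N`. Splitting `1` along this decomposition gives `1 + a`, and
the lower bound controls `‖a‖`. -/
theorem exists_mem_intertwiner_of_near {X₀ : Matrix ι ι ℂ} {N : Submodule ℂ (Matrix ι ι ℂ)}
    (hN : IsCompl (intertwiner X₀ X₀) N) :
    ∃ c > 0, ∀ (X Y : Matrix ι ι ℂ), ‖X - X₀‖ + ‖Y - X₀‖ < c →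
      Module.finrank ℂ (intertwiner X₀ X₀) ≤ Module.finrank ℂ (intertwiner X Y) →
      ∃ a ∈ N, X * (1 + a) = (1 + a) * Y ∧ c * ‖a‖ ≤ ‖Y - X‖ := by
  let T : N →ₗ[ℂ] Matrix ι ι ℂ :=
    (LinearMap.mulLeft ℂ X₀ - LinearMap.mulRight ℂ X₀).comp N.subtype
  have hT : LinearMap.ker T = ⊥ := by
    rw [LinearMap.ker_eq_bot']
    intro a ha
    have h1 : (a : Matrix ι ι ℂ) ∈ intertwiner X₀ X₀ := by
      rw [mem_intertwiner]
      exact sub_eq_zero.1 (by simpa [T] using ha)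
    exact Subtype.ext (Submodule.disjoint_def.1 hN.disjoint _ h1 a.2)
  obtain ⟨K, hK, hlip⟩ := T.exists_antilipschitzWith hT
  have hbound (a : Matrix ι ι ℂ) (ha : a ∈ N) : ‖a‖ ≤ K * ‖X₀ * a - a * X₀‖ := by
    have := hlip.le_mul_dist ⟨a, ha⟩ 0
    rw [map_zero, dist_zero_right, dist_zero_right] at this
    exact this
  have hK' : (0 : ℝ) < K := hK
  -- The lower bound `K⁻¹` loses at most half under the perturbation, so `(2 * K)⁻¹` serves both as
  -- radius and as bound.
  have hbound' (X Y : Matrix ι ι ℂ) (hXY : ‖X - X₀‖ + ‖Y - X₀‖ < (2 * K)⁻¹) (a : Matrix ι ι ℂ)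
      (ha : a ∈ N) : (2 * K : ℝ)⁻¹ * ‖a‖ ≤ ‖X * a - a * Y‖ := by
    have h1 : X₀ * a - a * X₀ = (X * a - a * Y) - ((X - X₀) * a - a * (Y - X₀)) := by
      noncomm_ring
    have h2 : ‖X₀ * a - a * X₀‖ ≤ ‖X * a - a * Y‖ + (‖X - X₀‖ * ‖a‖ + ‖a‖ * ‖Y - X₀‖) := by
      rw [h1]
      exact (norm_sub_le _ _).trans (add_le_add le_rfl ((norm_sub_le _ _).trans
        (add_le_add (norm_mul_le _ _) (norm_mul_le _ _))))
    have h3 := hbound a ha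
    have h4 : (‖X - X₀‖ + ‖Y - X₀‖) * ‖a‖ ≤ (2 * K : ℝ)⁻¹ * ‖a‖ :=
      mul_le_mul_of_nonneg_right hXY.le (norm_nonneg _)
    have h5 : (K : ℝ)⁻¹ * ‖a‖ ≤ ‖X₀ * a - a * X₀‖ := by
      rw [inv_mul_le_iff₀ hK']; exact h3
    have h6 : (K : ℝ)⁻¹ * ‖a‖ = (2 * K : ℝ)⁻¹ * ‖a‖ + (2 * K : ℝ)⁻¹ * ‖a‖ := by
      field_simp; ring
    linarith
  refine ⟨(2 * K)⁻¹, by positivity, fun X Y hXY hrank => ?_⟩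
  have hdisj : Disjoint (intertwiner X Y) N := by
    rw [Submodule.disjoint_def]
    intro a ha haN
    have := hbound' X Y hXY a haN
    rw [mem_intertwiner.1 ha, sub_self, norm_zero] at this
    have h0 : (0 : ℝ) < (2 * K : ℝ)⁻¹ := by positivity
    exact norm_le_zero_iff.1 (nonpos_of_mul_nonpos_right this h0)
  have htop : intertwiner X Y ⊔ N = ⊤ := by
    apply Submodule.eq_top_of_disjoint _ _ _ hdisj
    rw [← Submodule.finrank_add_eq_of_isCompl hN]
    omega
  obtain ⟨A, hA, b, hb, hAb⟩ := Submodule.mem_sup.1 (htop ▸ Submodule.mem_top :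
    (1 : Matrix ι ι ℂ) ∈ intertwiner X Y ⊔ N)
  have hA' : A = 1 + -b := by rw [← hAb]; abel
  rw [hA'] at hA
  refine ⟨-b, N.neg_mem hb, hA, ?_⟩
  refine (hbound' X Y hXY (-b) (N.neg_mem hb)).trans_eq ?_
  congr 1
  rw [mem_intertwiner, mul_add, add_mul, mul_one, one_mul] at hA
  rw [sub_eq_sub_iff_add_eq_add, add_comm, hA, add_comm]

/-- Sets of matrices that are locally swept out by conjugating an affine family of matrices with
constant centralizer are submanifolds. -/
theorem exists_chart_of_conjugation {S : Set (Matrix ι ι ℂ)} {C : (κ → ℝ) → Matrix ι ι ℂ}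
    {M : Matrix ι ι ℂ} {P : κ → Matrix ι ι ℂ} {x₀ : κ → ℝ}
    (hC : ∀ x, C x = M + ∑ i, x i • (Complex.I • P i))
    (hcomm : ∀ i, C x₀ * P i = P i * C x₀)
    (htr : ∀ i j, i ≠ j → (P i * P j).trace = 0) (htr' : ∀ i, (P i * P i).trace ≠ 0)
    (hrank : ∀ᶠ x in 𝓝 x₀, Module.finrank ℂ (intertwiner (C x₀) (C x₀)) ≤
      Module.finrank ℂ (intertwiner (C x) (C x)))
    (hmem : ∀ᶠ x in 𝓝 x₀, ∀ g : (Matrix ι ι ℂ)ˣ, g.val * C x * (g⁻¹).val ∈ S)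
    (hnear : ∀ W ∈ 𝓝 x₀, ∀ᶠ X in 𝓝[S] (C x₀), ∃ x ∈ W, ∃ g : (Matrix ι ι ℂ)ˣ,
      X = g.val * C x * (g⁻¹).val) :
    ∃ (φ : OpenPartialHomeomorph (Matrix ι ι ℂ) (Matrix ι ι ℂ))
      (L : Submodule ℝ (Matrix ι ι ℂ)),
      C x₀ ∈ φ.source ∧ ContDiffOn ℝ ∞ φ φ.source ∧ ContDiffOn ℝ ∞ φ.symm φ.target ∧
      φ '' (S ∩ φ.source) = (L : Set (Matrix ι ι ℂ)) ∩ φ.target ∧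
      Module.finrank ℝ L = Fintype.card κ +
        2 * (Fintype.card ι ^ 2 - Module.finrank ℂ (intertwiner (C x₀) (C x₀))) := by
  obtain ⟨N, hN⟩ := Submodule.exists_isCompl (intertwiner (C x₀) (C x₀))
  set NR : Submodule ℝ (Matrix ι ι ℂ) := N.restrictScalars ℝ with hNR
  have hfr : Module.finrank ℝ (NR × (κ → ℝ)) = Fintype.card κ +
      2 * (Fintype.card ι ^ 2 - Module.finrank ℂ (intertwiner (C x₀) (C x₀))) := by
    have h1 : Module.finrank ℝ NR = 2 * Module.finrank ℂ N := by
      rw [← Complex.finrank_real_complex]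
      exact (Module.finrank_mul_finrank ℝ ℂ N).symm
    have h2 := Submodule.finrank_add_eq_of_isCompl hN
    rw [Module.finrank_matrix, Module.finrank_self, mul_one, ← pow_two] at h2
    rw [Module.finrank_prod, Module.finrank_fintype_fun_eq_card, h1]
    omega
  rw [← hfr]
  let D : (κ → ℝ) →ₗ[ℝ] Matrix ι ι ℂ :=
    Fintype.linearCombination ℝ (fun i => Complex.I • P i)
  have hCD (x t : κ → ℝ) : C (x + t) = C x + D t := by
    simp [hC, D, Fintype.linearCombination_apply, add_smul, Finset.sum_add_distrib, add_assoc]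
  have hC' : ContDiff ℝ ω C := by
    have : C = fun x => M + LinearMap.toContinuousLinearMap D x := by
      ext1 x; simp [hC, D, Fintype.linearCombination_apply]
    rw [this]
    exact contDiff_const.add (LinearMap.toContinuousLinearMap D).contDiff
  have hCc : Continuous C := hC'.continuous
  set pN : NR × (κ → ℝ) →L[ℝ] Matrix ι ι ℂ := NR.subtypeL.comp (ContinuousLinearMap.fst ℝ _ _)
    with hpN
  set pT : NR × (κ → ℝ) →L[ℝ] (κ → ℝ) := ContinuousLinearMap.snd ℝ _ _ with hpT
  -- Its derivative at `0` is `(a, t) ↦ D t + a * C x₀ - C x₀ * a`.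
  set G : NR × (κ → ℝ) → Matrix ι ι ℂ :=
    fun v => (1 + pN v) * (C x₀ + D (pT v)) * Ring.inverse (1 + pN v) with hG
  have hA : ContDiffAt ℝ ω (fun v => 1 + pN v) 0 := contDiffAt_const.add pN.contDiff.contDiffAt
  have hA' : HasFDerivAt (fun v => 1 + pN v) pN 0 := pN.hasFDerivAt.const_add 1
  have hB : ContDiffAt ℝ ω (fun v => C x₀ + D (pT v)) 0 :=
    contDiffAt_const.add
      (((LinearMap.toContinuousLinearMap D).comp pT).contDiff.contDiffAt)
  have hB' : HasFDerivAt (fun v => C x₀ + D (pT v))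
      ((LinearMap.toContinuousLinearMap D).comp pT) 0 :=
    ((LinearMap.toContinuousLinearMap D).comp pT).hasFDerivAt.const_add _
  have h10 : (1 : Matrix ι ι ℂ) + pN 0 = ((1 : (Matrix ι ι ℂ)ˣ) : Matrix ι ι ℂ) := by simp
  have hI : ContDiffAt ℝ ω (fun v => Ring.inverse (1 + pN v)) 0 := by
    have h : ContDiffAt ℝ ω Ring.inverse (1 + pN 0) := by
      rw [h10]; exact contDiffAt_ringInverse ℝ 1
    exact h.comp (0 : NR × (κ → ℝ)) hA
  have hI' : HasFDerivAt (fun v => Ring.inverse (1 + pN v)) (-pN) 0 := by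
    have h : HasFDerivAt (𝕜 := ℝ) Ring.inverse
        (-ContinuousLinearMap.mulLeftRight ℝ (Matrix ι ι ℂ) (1 : Matrix ι ι ℂ) 1) (1 + pN 0) := by
      rw [h10]
      simpa using hasFDerivAt_ringInverse (𝕜 := ℝ) (1 : (Matrix ι ι ℂ)ˣ)
    refine (h.comp (0 : NR × (κ → ℝ)) hA').congr_fderiv ?_
    refine ContinuousLinearMap.ext fun v => ?_
    change -(1 * pN v * 1) = -pN v
    rw [one_mul, mul_one]
  have hG' := (hA'.mul' hB').mul' hI'
  have hGω : ContDiffAt ℝ ω G 0 := (hA.mul hB).mul hI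
  have hval (a : Matrix ι ι ℂ) (ha : a ∈ NR) (t : κ → ℝ) (u : (Matrix ι ι ℂ)ˣ)
      (hu : (u : Matrix ι ι ℂ) = 1 + a) : G (⟨a, ha⟩, t) = u.val * C (x₀ + t) * (u⁻¹).val := by
    rw [hCD]
    simp only [hG, hpN, hpT]
    change (1 + a) * (C x₀ + D t) * Ring.inverse (1 + a) = _
    rw [← hu, Ring.inverse_unit]
  refine exists_chart_of_immersion hGω hG' ?_ ?_ ?_ ?_
  · rw [← ContinuousLinearMap.coe_coe, ← LinearMap.ker_eq_bot, LinearMap.ker_eq_bot']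
    rintro ⟨a, t⟩ h
    have h : D t + a * C x₀ - C x₀ * a = 0 := by
      simp [hpN, hpT] at h
      change C x₀ * -a.val + ((1 : Matrix ι ι ℂ) * D t + a.val * C x₀) = 0 at h
      rw [one_mul, mul_neg] at h
      rw [← h]; abel
    -- Multiply by `P j` and take the trace: the commutator contributes nothing because `P j`
    -- commutes with `C x₀`, and orthogonality of the `P i` isolates `t j`.
    have ht : t = 0 := by
      funext j
      have h1 := congrArg (fun Y => (Y * P j).trace) h
      simp only [sub_mul, add_mul, Matrix.trace_sub, Matrix.trace_add, zero_mul,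
        Matrix.trace_zero] at h1
      have h2 : (C x₀ * a * P j).trace = (a * C x₀ * P j).trace := by
        rw [mul_assoc, Matrix.trace_mul_comm, mul_assoc, mul_assoc, hcomm]
      have h3 : (D t * P j).trace = t j • (Complex.I • (P j * P j).trace) := by
        simp only [D, Fintype.linearCombination_apply, Finset.sum_mul, Matrix.trace_sum,
          Matrix.smul_mul, Matrix.trace_smul]
        rw [Finset.sum_eq_single j (fun i _ hij => by simp [htr i j hij]) (by simp)]
      rw [h2, h3, add_sub_cancel_right] at h1
      simpa [htr' j] using h1
    subst ht
    rw [map_zero, zero_add, sub_eq_zero] at h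
    have ha : (a : Matrix ι ι ℂ) = 0 :=
      Submodule.disjoint_def.1 hN.disjoint _ (mem_intertwiner.2 h.symm) a.2
    ext1
    · exact Subtype.ext ha
    · rfl
  · simp [hG]
  · have h1 : Tendsto (fun v : NR × (κ → ℝ) => x₀ + pT v) (𝓝 0) (𝓝 x₀) := by
      have : Continuous (fun v : NR × (κ → ℝ) => x₀ + pT v) := by fun_prop
      simpa using this.tendsto 0
    have h2 : ∀ᶠ v in 𝓝 (0 : NR × (κ → ℝ)), IsUnit (1 + pN v) := by
      have : Tendsto (fun v => 1 + pN v) (𝓝 0) (𝓝 (1 + pN 0)) := hA.continuousAt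
      refine this.eventually (Units.isOpen.eventually_mem ?_)
      rw [h10]
      exact ⟨1, rfl⟩
    filter_upwards [h1.eventually hmem, h2] with v hv hv2
    obtain ⟨u, hu⟩ := hv2
    have := hval v.1 v.1.2 v.2 u hu
    rw [show v = (⟨v.1, v.1.2⟩, v.2) from rfl, this]
    exact hv u
  · intro W hW
    obtain ⟨ε, hε, hball⟩ := Metric.mem_nhds_iff.1 hW
    obtain ⟨c, hc, hnb⟩ := exists_mem_intertwiner_of_near hN
    have hunit : ∀ᶠ a : Matrix ι ι ℂ in 𝓝 0, IsUnit (1 + a) := by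
      have : Tendsto (fun a : Matrix ι ι ℂ => 1 + a) (𝓝 0) (𝓝 1) := by
        have h : Continuous fun a : Matrix ι ι ℂ => 1 + a := by fun_prop
        simpa using h.tendsto 0
      exact this.eventually (Units.isOpen.eventually_mem ⟨1, rfl⟩)
    obtain ⟨ε', hε', hunit'⟩ := Metric.eventually_nhds_iff.1 hunit
    -- The bounds on `δ` ensure that `exists_mem_intertwiner_of_near` applies, that `(a, x - x₀)`
    -- lands in `W`, and that `1 + a` is invertible.
    obtain ⟨δ, hδ0, hδc, hδε, hδε'⟩ : ∃ δ > 0, δ ≤ c ∧ δ ≤ c * ε ∧ δ ≤ c * ε' :=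
      ⟨min c (min (c * ε) (c * ε')), by positivity, min_le_left _ _,
        (min_le_right _ _).trans (min_le_left _ _), (min_le_right _ _).trans (min_le_right _ _)⟩
    have hx : ∀ᶠ x in 𝓝 x₀, ‖C x - C x₀‖ < δ / 2 := by
      have : Tendsto (fun x => ‖C x - C x₀‖) (𝓝 x₀) (𝓝 0) := by
        have h : Continuous (fun x => ‖C x - C x₀‖) := by fun_prop
        simpa using h.tendsto x₀
      exact this.eventually_lt_const (by positivity)
    have hX : ∀ᶠ X in 𝓝[S] (C x₀), ‖X - C x₀‖ < δ / 2 := by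
      apply Filter.Eventually.filter_mono nhdsWithin_le_nhds
      have : Tendsto (fun X => ‖X - C x₀‖) (𝓝 (C x₀)) (𝓝 0) := by
        have h : Continuous (fun X => ‖X - C x₀‖) := by fun_prop
        simpa using h.tendsto (C x₀)
      exact this.eventually_lt_const (by positivity)
    filter_upwards [hX, hnear _ ((hx.and hrank).and (Metric.ball_mem_nhds x₀ hε))] with X hX1 hX2
    obtain ⟨x, ⟨⟨hx1, hx2⟩, hx3⟩, g, rfl⟩ := hX2
    -- The conjugator `g` need not be near `1`; it only supplies the dimension of the intertwiner
    -- space, from which a conjugator `1 + a` with small `a` is obtained.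
    rw [finrank_intertwiner_conj g (C x)] at hx2
    have hsum : ‖g.val * C x * (g⁻¹).val - C x₀‖ + ‖C x - C x₀‖ < δ := by linarith
    obtain ⟨a, ha, haX, hac⟩ := hnb _ _ (hsum.trans_le hδc) hx2
    have hac' : c * ‖a‖ < δ := by
      refine hac.trans_lt (lt_of_le_of_lt ?_ hsum)
      rw [show C x - g.val * C x * (g⁻¹).val =
        (C x - C x₀) - (g.val * C x * (g⁻¹).val - C x₀) by abel, add_comm]
      exact norm_sub_le _ _
    obtain ⟨u, hu⟩ := hunit' (show dist a 0 < ε' by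
      rw [dist_zero_right]; exact lt_of_mul_lt_mul_left (hac'.trans_le hδε') hc.le)
    refine ⟨(⟨a, ha⟩, x - x₀), hball ?_, ?_⟩
    · rw [mem_ball_zero_iff, Prod.norm_def, max_lt_iff]
      refine ⟨lt_of_mul_lt_mul_left (hac'.trans_le hδε) hc.le, ?_⟩
      rw [← dist_eq_norm]; exact hx3
    · rw [hval a ha _ u hu, add_sub_cancel]
      rw [← hu] at haX
      rw [← haX, mul_assoc _ u.val, Units.mul_inv, mul_one]

end ConjugationOrbits

/-! ### Similarity across index types, nullity and block diagonal matrices -/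

section Similarity

variable {l m n : Type*} [Fintype l] [Fintype m] [Fintype n]

theorem conj_mul_conj_of_mul_eq_one [DecidableEq n] {A A' : Matrix m m ℂ} {B B' : Matrix n n ℂ} {P : Matrix m n ℂ} {Q : Matrix n m ℂ}
    (hQP : Q * P = 1) (h : A = P * B * Q) (h' : A' = P * B' * Q) :
    A * A' = P * (B * B') * Q := by
  rw [h, h', Matrix.mul_assoc, ← Matrix.mul_assoc Q, ← Matrix.mul_assoc Q, hQP, Matrix.one_mul]
  simp only [Matrix.mul_assoc]

/-- The dimension of the kernel of a matrix. -/
noncomputable def matrixNullity (A : Matrix n n ℂ) : ℕ :=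
  Module.finrank ℂ (LinearMap.ker A.mulVecLin)

theorem matrixNullity_add_rank (A : Matrix n n ℂ) :
    A.rank + matrixNullity A = Fintype.card n := by
  have := LinearMap.finrank_range_add_finrank_ker A.mulVecLin
  rwa [Module.finrank_fintype_fun_eq_card] at this

variable [DecidableEq l] [DecidableEq m] [DecidableEq n]

/-- Similarity of square matrices with possibly different index types. -/
def IsSimilarMatrix (A : Matrix m m ℂ) (B : Matrix n n ℂ) : Prop :=
  ∃ (P : Matrix m n ℂ) (Q : Matrix n m ℂ), P * Q = 1 ∧ Q * P = 1 ∧ A = P * B * Q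

namespace IsSimilarMatrix

theorem refl (A : Matrix m m ℂ) : IsSimilarMatrix A A := ⟨1, 1, by simp⟩

theorem symm {A : Matrix m m ℂ} {B : Matrix n n ℂ} (h : IsSimilarMatrix A B) :
    IsSimilarMatrix B A := by
  obtain ⟨P, Q, hPQ, hQP, rfl⟩ := h
  refine ⟨Q, P, hQP, hPQ, ?_⟩
  rw [Matrix.mul_assoc P, ← Matrix.mul_assoc Q, hQP, Matrix.one_mul, Matrix.mul_assoc, hQP,
    Matrix.mul_one]

theorem trans {A : Matrix l l ℂ} {B : Matrix m m ℂ} {C : Matrix n n ℂ}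
    (h : IsSimilarMatrix A B) (h' : IsSimilarMatrix B C) : IsSimilarMatrix A C := by
  obtain ⟨P, Q, hPQ, hQP, rfl⟩ := h
  obtain ⟨P', Q', hPQ', hQP', rfl⟩ := h'
  refine ⟨P * P', Q' * Q, ?_, ?_, ?_⟩
  · rw [Matrix.mul_assoc, ← Matrix.mul_assoc P', hPQ', Matrix.one_mul, hPQ]
  · rw [Matrix.mul_assoc, ← Matrix.mul_assoc Q, hQP, Matrix.one_mul, hQP']
  · simp only [Matrix.mul_assoc]

theorem pow {A : Matrix m m ℂ} {B : Matrix n n ℂ} (h : IsSimilarMatrix A B) (k : ℕ) :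
    IsSimilarMatrix (A ^ k) (B ^ k) := by
  obtain ⟨P, Q, hPQ, hQP, hA⟩ := h
  refine ⟨P, Q, hPQ, hQP, ?_⟩
  induction k with
  | zero => simp [hPQ]
  | succ k ih => rw [pow_succ, pow_succ, conj_mul_conj_of_mul_eq_one hQP ih hA]

theorem sub_smul_one {A : Matrix m m ℂ} {B : Matrix n n ℂ} (h : IsSimilarMatrix A B) (z : ℂ) :
    IsSimilarMatrix (A - z • 1) (B - z • 1) := by
  obtain ⟨P, Q, hPQ, hQP, rfl⟩ := h
  refine ⟨P, Q, hPQ, hQP, ?_⟩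
  simp [Matrix.mul_sub, Matrix.sub_mul, hPQ]

theorem det_eq {A : Matrix m m ℂ} {B : Matrix n n ℂ} (h : IsSimilarMatrix A B) :
    A.det = B.det := by
  obtain ⟨P, Q, hPQ, hQP, rfl⟩ := h
  exact Matrix.det_conj_of_mul_eq_one hPQ hQP

theorem of_equiv (e : m ≃ n) (A : Matrix n n ℂ) : IsSimilarMatrix (A.submatrix e e) A := by
  refine ⟨(1 : Matrix n n ℂ).submatrix e id, (1 : Matrix n n ℂ).submatrix id e, ?_, ?_, ?_⟩
  · rw [← Matrix.submatrix_mul _ _ _ _ _ Function.bijective_id]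
    simp
  · rw [Matrix.submatrix_mul_equiv]
    simp
  · ext i j
    simp [Matrix.mul_apply, Matrix.submatrix_apply, Matrix.one_apply]

theorem blockDiagonal {o : Type*} [Fintype o] [DecidableEq o] {m n : o → Type*}
    [∀ i, Fintype (m i)] [∀ i, Fintype (n i)] [∀ i, DecidableEq (m i)] [∀ i, DecidableEq (n i)]
    {A : ∀ i, Matrix (m i) (m i) ℂ} {B : ∀ i, Matrix (n i) (n i) ℂ}
    (h : ∀ i, IsSimilarMatrix (A i) (B i)) :
    IsSimilarMatrix (blockDiagonal' A) (blockDiagonal' B) := by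
  choose P Q hPQ hQP hA using h
  refine ⟨blockDiagonal' P, blockDiagonal' Q, ?_, ?_, ?_⟩
  · rw [← blockDiagonal'_mul]; simp only [hPQ]; exact blockDiagonal'_one
  · rw [← blockDiagonal'_mul]; simp only [hQP]; exact blockDiagonal'_one
  · rw [← blockDiagonal'_mul, ← blockDiagonal'_mul]; congr 1; funext i; exact hA i

theorem blockDiagonal_comp_equiv {o o' : Type*} [Fintype o] [DecidableEq o] [Fintype o']
    [DecidableEq o'] (σ : o ≃ o') {m : o' → Type*} [∀ i, Fintype (m i)]
    [∀ i, DecidableEq (m i)] (A : ∀ i, Matrix (m i) (m i) ℂ) :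
    IsSimilarMatrix (blockDiagonal' fun i => A (σ i)) (blockDiagonal' A) := by
  convert of_equiv (Equiv.sigmaCongrLeft (β := m) σ) (blockDiagonal' A) using 1
  ext ⟨i, a⟩ ⟨j, b⟩
  by_cases hij : i = j
  · subst hij; simp [blockDiagonal'_apply]
  · simp [blockDiagonal'_apply, hij]

theorem blockDiagonal_sigma {o : Type*} [Fintype o] [DecidableEq o] {r : o → Type*}
    [∀ i, Fintype (r i)] [∀ i, DecidableEq (r i)] {m : (Σ i, r i) → Type*}
    [∀ i, Fintype (m i)] [∀ i, DecidableEq (m i)] (A : ∀ i, Matrix (m i) (m i) ℂ) :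
    IsSimilarMatrix (blockDiagonal' A)
      (blockDiagonal' fun i => blockDiagonal' fun j : r i => A ⟨i, j⟩) := by
  convert of_equiv (Equiv.sigmaAssoc (fun i j => m ⟨i, j⟩))
    (blockDiagonal' fun i => blockDiagonal' fun j : r i => A ⟨i, j⟩) using 1
  ext ⟨⟨i, a⟩, b⟩ ⟨⟨i', a'⟩, b'⟩
  by_cases hij : i = i'
  · subst hij
    by_cases ha : a = a'
    · subst ha; simp [blockDiagonal'_apply, Equiv.sigmaAssoc]
    · simp [blockDiagonal'_apply, Equiv.sigmaAssoc, ha]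
  · simp [blockDiagonal'_apply, Equiv.sigmaAssoc, hij]

theorem iff_exists_units {A B : Matrix n n ℂ} :
    IsSimilarMatrix A B ↔ ∃ g : (Matrix n n ℂ)ˣ, A = g.val * B * (g⁻¹).val := by
  constructor
  · rintro ⟨P, Q, hPQ, hQP, rfl⟩
    exact ⟨⟨P, Q, hPQ, hQP⟩, rfl⟩
  · rintro ⟨g, rfl⟩
    exact ⟨g.val, (g⁻¹).val, by simp, by simp, rfl⟩

end IsSimilarMatrix

theorem IsSimilarMatrix.matrixNullity_le {A : Matrix m m ℂ} {B : Matrix n n ℂ}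
    (h : IsSimilarMatrix A B) : matrixNullity B ≤ matrixNullity A := by
  obtain ⟨P, Q, hPQ, hQP, rfl⟩ := h
  refine LinearMap.finrank_le_finrank_of_injective
    (f := P.mulVecLin.restrict (p := LinearMap.ker B.mulVecLin) fun v hv => ?_) ?_
  · simp only [LinearMap.mem_ker, mulVecLin_apply] at hv ⊢
    rw [mulVec_mulVec, Matrix.mul_assoc, hQP, Matrix.mul_one, ← mulVec_mulVec, hv, mulVec_zero]
  · intro u v huv
    have h := congrArg (fun w => Q *ᵥ w) (congrArg Subtype.val huv)
    simp only [LinearMap.coe_restrict_apply, mulVecLin_apply, mulVec_mulVec, hQP, one_mulVec] at h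
    exact Subtype.ext h

theorem IsSimilarMatrix.matrixNullity_eq {A : Matrix m m ℂ} {B : Matrix n n ℂ}
    (h : IsSimilarMatrix A B) : matrixNullity A = matrixNullity B :=
  h.symm.matrixNullity_le.antisymm h.matrixNullity_le

theorem matrixNullity_eq_zero_iff {A : Matrix n n ℂ} : matrixNullity A = 0 ↔ IsUnit A := by
  rw [matrixNullity, Submodule.finrank_eq_zero, Matrix.ker_mulVecLin_eq_bot_iff,
    ← Matrix.mulVec_injective_iff_isUnit, ← Matrix.coe_mulVecLin, ← LinearMap.ker_eq_bot,
    LinearMap.ker_eq_bot']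

theorem matrixNullity_blockDiagonal' {o : Type*} [Fintype o] [DecidableEq o] {m : o → Type*}
    [∀ i, Fintype (m i)] [∀ i, DecidableEq (m i)] (A : ∀ i, Matrix (m i) (m i) ℂ) :
    matrixNullity (blockDiagonal' A) = ∑ i, matrixNullity (A i) := by
  have happ (v : (Σ i, m i) → ℂ) (i : o) (a : m i) :
      (blockDiagonal' A *ᵥ v) ⟨i, a⟩ = (A i *ᵥ fun b => v ⟨i, b⟩) a := by
    simp only [mulVec, dotProduct, Fintype.sum_sigma]
    rw [Finset.sum_eq_single i]
    · simp
    · intro j _ hj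
      exact Finset.sum_eq_zero fun b _ => by rw [blockDiagonal'_apply_ne _ _ _ hj.symm, zero_mul]
    · simp
  let e : LinearMap.ker (blockDiagonal' A).mulVecLin ≃ₗ[ℂ]
      ∀ i, LinearMap.ker (A i).mulVecLin :=
    { toFun := fun v i => ⟨fun b => v.1 ⟨i, b⟩, by
        rw [LinearMap.mem_ker]
        funext a
        rw [mulVecLin_apply, ← happ]
        exact congrFun v.2 ⟨i, a⟩⟩
      map_add' := fun u v => rfl
      map_smul' := fun c v => rfl
      invFun := fun v => ⟨fun a => (v a.1).1 a.2, by
        rw [LinearMap.mem_ker]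
        funext a
        rw [mulVecLin_apply, happ]
        exact congrFun (v a.1).2 a.2⟩
      left_inv := fun v => rfl
      right_inv := fun v => rfl }
  rw [matrixNullity, e.finrank_eq, Module.finrank_pi_fintype]
  rfl

theorem matrixNullity_blockDiagonal'_pow {o : Type*} [Fintype o] [DecidableEq o] {m : o → Type*}
    [∀ i, Fintype (m i)] [∀ i, DecidableEq (m i)] (A : ∀ i, Matrix (m i) (m i) ℂ) (z : ℂ) (k : ℕ) :
    matrixNullity ((blockDiagonal' A - z • 1) ^ k) = ∑ i, matrixNullity ((A i - z • 1) ^ k) := by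
  rw [← matrixNullity_blockDiagonal']
  congr 1
  change _ = blockDiagonal' ((fun i => A i - z • 1) ^ k)
  rw [blockDiagonal'_pow]
  congr 1
  change _ = blockDiagonal' (A - z • 1)
  rw [blockDiagonal'_sub, blockDiagonal'_smul, blockDiagonal'_one]

theorem det_blockDiagonal'_eq_prod {o : Type*} [Fintype o] [DecidableEq o] {m : o → Type*}
    [∀ i, Fintype (m i)] [∀ i, DecidableEq (m i)] (A : ∀ i, Matrix (m i) (m i) ℂ) :
    (blockDiagonal' A).det = ∏ i, (A i).det := by
  -- Any linear order will do: block diagonal matrices are block triangular for each of them.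
  let : LinearOrder o := LinearOrder.lift' (Fintype.equivFin o) (Fintype.equivFin o).injective
  rw [(blockTriangular_blockDiagonal' A).det_fintype]
  refine Finset.prod_congr rfl fun i _ => ?_
  let e : m i ≃ {a : Σ i, m i // a.1 = i} :=
    { toFun := fun a => ⟨⟨i, a⟩, rfl⟩
      invFun := fun a => a.2 ▸ a.1.2
      left_inv := fun a => rfl
      right_inv := by rintro ⟨⟨j, a⟩, rfl⟩; rfl }
  rw [← Matrix.det_submatrix_equiv_self e]
  congr 1
  ext a b
  simp [e, toSquareBlock_def]

theorem det_blockDiagonal'_sub_smul {o : Type*} [Fintype o] [DecidableEq o] {m : o → Type*}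
    [∀ i, Fintype (m i)] [∀ i, DecidableEq (m i)] (A : ∀ i, Matrix (m i) (m i) ℂ) (z : ℂ) :
    (blockDiagonal' A - z • 1).det = ∏ i, (A i - z • 1).det := by
  rw [← det_blockDiagonal'_eq_prod]
  congr 1
  change _ = blockDiagonal' (A - z • 1)
  rw [blockDiagonal'_sub, blockDiagonal'_smul, blockDiagonal'_one]

end Similarity

/-! ### Powers and nullities of a Jordan block -/

section JordanBlock

theorem jordanBlockMatrix_sub_smul_pow_apply (s : ℕ) (z : ℂ) (m : ℕ) (i j : Fin s) :
    ((jordanBlockMatrix s z - z • 1) ^ m) i j = if (i : ℕ) + m = j then 1 else 0 := by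
  induction m generalizing j with
  | zero => simp [Matrix.one_apply, Fin.ext_iff]
  | succ m ih =>
    rw [pow_succ, Matrix.mul_apply]
    have hN (l : Fin s) : (jordanBlockMatrix s z - z • 1) l j =
        if (l : ℕ) + 1 = j then 1 else 0 := by
      by_cases hl : l = j
      · subst hl; simp [jordanBlockMatrix]
      · simp [jordanBlockMatrix, hl]
    simp only [ih, hN, ite_mul, one_mul, zero_mul]
    by_cases h : (i : ℕ) + m < s
    · rw [Finset.sum_eq_single ⟨i + m, h⟩]
      · simp [add_assoc]
      · intro l _ hl
        rw [if_neg]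
        intro h'
        exact hl (Fin.ext h'.symm)
      · simp
    · rw [Finset.sum_eq_zero, if_neg]
      · omega
      · intro l _
        rw [if_neg]
        omega

theorem matrixNullity_jordanBlockMatrix_self (s : ℕ) (z : ℂ) (m : ℕ) :
    matrixNullity ((jordanBlockMatrix s z - z • 1) ^ m) = min s m := by
  -- The `m`-th power shifts coordinates down by `m`, so its kernel consists of the vectors
  -- supported on the first `m` coordinates.
  have hker : LinearMap.ker ((jordanBlockMatrix s z - z • 1) ^ m).mulVecLin =
      ⨅ i ∈ {j : Fin s | m ≤ j}, LinearMap.ker (LinearMap.proj i : (Fin s → ℂ) →ₗ[ℂ] ℂ) := by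
    ext v
    simp only [LinearMap.mem_ker, mulVecLin_apply, Submodule.mem_iInf, LinearMap.proj_apply,
      Set.mem_ofPred_eq]
    have happ (i : Fin s) : (((jordanBlockMatrix s z - z • 1) ^ m) *ᵥ v) i =
        if h : (i : ℕ) + m < s then v ⟨i + m, h⟩ else 0 := by
      simp only [mulVec, dotProduct, jordanBlockMatrix_sub_smul_pow_apply, ite_mul, one_mul,
        zero_mul]
      split_ifs with h
      · rw [Finset.sum_eq_single ⟨i + m, h⟩]
        · simp
        · intro l _ hl
          rw [if_neg]
          intro h'
          exact hl (Fin.ext h'.symm)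
        · simp
      · refine Finset.sum_eq_zero fun l _ => ?_
        rw [if_neg]
        omega
    constructor
    · intro h j hj
      have := congrFun h ⟨j - m, by omega⟩
      rw [happ, dif_pos (by simp; omega)] at this
      simpa [Nat.sub_add_cancel hj] using this
    · intro h
      funext i
      rw [happ]
      split_ifs with h'
      · exact h _ (by simp)
      · rfl
  have hdisj : Disjoint {j : Fin s | (j : ℕ) < m} {j : Fin s | m ≤ j} := by
    rw [Set.disjoint_left]
    intro j hj hj'
    simp only [Set.mem_ofPred_eq] at hj hj'
    omega
  have e := LinearMap.iInfKerProjEquiv ℂ (fun _ : Fin s => ℂ) hdisj (fun j _ => by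
    by_cases h : (j : ℕ) < m
    · exact Or.inl h
    · exact Or.inr (not_lt.1 h))
  rw [matrixNullity, hker, e.finrank_eq, Module.finrank_fintype_fun_eq_card]
  rw [← Fin.card_filter_val_lt, Fintype.card_subtype]
  simp

theorem det_jordanBlockMatrix_sub_smul (s : ℕ) (z w : ℂ) :
    (jordanBlockMatrix s z - w • 1).det = (z - w) ^ s := by
  rw [Matrix.det_of_isUpperTriangular]
  · simp [jordanBlockMatrix]
  · intro i j hij
    have h1 : i ≠ j := fun h => by simp [h] at hij
    have h2 : (i : ℕ) + 1 ≠ j := by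
      have : (j : ℕ) < i := hij
      omega
    simp [jordanBlockMatrix, h1, h2]

theorem matrixNullity_jordanBlockMatrix_of_ne (s : ℕ) {z w : ℂ} (h : z ≠ w) (m : ℕ) :
    matrixNullity ((jordanBlockMatrix s z - w • 1) ^ m) = 0 := by
  rw [matrixNullity_eq_zero_iff]
  apply IsUnit.pow
  rw [Matrix.isUnit_iff_isUnit_det, det_jordanBlockMatrix_sub_smul, isUnit_iff_ne_zero]
  exact pow_ne_zero _ (sub_ne_zero.2 h)

end JordanBlock

/-! ### Partitions are determined by their nullities -/

namespace TuplePartition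

variable {n n' : ℕ}

/-- The dimension of the kernel of the `m`-th power of a nilpotent matrix with Jordan blocks of the
sizes given by a partition. -/
def nullity (p : TuplePartition n) (m : ℕ) : ℕ := ∑ a, min (p.part a) m

theorem part_le (p : TuplePartition n) (a : Fin p.length) : p.part a ≤ n := by
  conv_rhs => rw [← p.sum_part]
  exact Finset.single_le_sum (f := p.part) (fun _ _ => Nat.zero_le _) (Finset.mem_univ a)

theorem length_le (p : TuplePartition n) : p.length ≤ n := by
  conv_rhs => rw [← p.sum_part]
  simpa using Finset.sum_le_sum (s := Finset.univ) fun a _ => p.one_le_part a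

theorem nullity_of_le (p : TuplePartition n) {m : ℕ} (h : n ≤ m) : p.nullity m = n := by
  conv_rhs => rw [← p.sum_part]
  exact Finset.sum_congr rfl fun a _ => min_eq_left ((p.part_le a).trans h)

theorem nullity_one (p : TuplePartition n) : p.nullity 1 = p.length := by
  simp [nullity, p.one_le_part]

theorem nullity_succ (p : TuplePartition n) (m : ℕ) :
    p.nullity (m + 1) = p.nullity m + (Finset.univ.filter fun a => m < p.part a).card := by
  rw [nullity, nullity, Finset.card_filter, ← Finset.sum_add_distrib]
  refine Finset.sum_congr rfl fun a _ => ?_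
  split_ifs with h <;> omega

/-- The parts are decreasing, so those larger than `m` form an initial segment, which is determined
by its cardinality. -/
theorem lt_part_iff (p : TuplePartition n) (m : ℕ) (a : Fin p.length) :
    m < p.part a ↔ (a : ℕ) < (Finset.univ.filter fun a => m < p.part a).card := by
  constructor
  · intro h
    have hsub : Finset.Iic a ⊆ Finset.univ.filter fun a => m < p.part a := fun b hb => by
      simpa using h.trans_le (p.antitone_part (Finset.mem_Iic.1 hb))
    have := Finset.card_le_card hsub
    rw [Fin.card_Iic] at this
    omega
  · intro h
    by_contra h'
    have hsub : (Finset.univ.filter fun a => m < p.part a) ⊆ Finset.Iio a := fun b hb => by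
      rw [Finset.mem_Iio]
      by_contra hab
      have := p.antitone_part (not_lt.1 hab)
      simp at hb
      omega
    have := Finset.card_le_card hsub
    rw [Fin.card_Iio] at this
    omega

theorem ext_of_length {p q : TuplePartition n} (h : p.length = q.length)
    (h' : ∀ a, p.part a = q.part (Fin.cast h a)) : p = q := by
  obtain ⟨k, f, _, _, _⟩ := p
  obtain ⟨k', g, _, _, _⟩ := q
  obtain rfl : k = k' := h
  obtain rfl : f = g := funext h'
  rfl

theorem eq_of_nullity_eq {p q : TuplePartition n} (h : ∀ m, p.nullity m = q.nullity m) :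
    p = q := by
  have hcard (m : ℕ) : (Finset.univ.filter fun a => m < p.part a).card =
      (Finset.univ.filter fun a => m < q.part a).card := by
    have := p.nullity_succ m
    have := q.nullity_succ m
    have := h m
    have := h (m + 1)
    omega
  have hlen : p.length = q.length := by
    rw [← p.nullity_one, ← q.nullity_one, h]
  refine ext_of_length hlen fun a => ?_
  have hiff (m : ℕ) : m < p.part a ↔ m < q.part (Fin.cast hlen a) := by
    rw [lt_part_iff, lt_part_iff, hcard]
    rfl
  have h1 := hiff (p.part a)
  have h2 := hiff (q.part (Fin.cast hlen a))
  omega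

theorem isSimilarMatrix_blockMatrix (p : TuplePartition n)
    (M : ∀ i : Fin p.length, Matrix (Fin (p.part i)) (Fin (p.part i)) ℂ) :
    IsSimilarMatrix (p.blockMatrix M) (blockDiagonal' M) := by
  rw [TuplePartition.blockMatrix, Matrix.reindex_apply]
  exact IsSimilarMatrix.of_equiv _ (blockDiagonal' M)

theorem isSimilarMatrix_jordanMatrix (p : TuplePartition n) (z : ℂ) :
    IsSimilarMatrix (p.jordanMatrix z)
      (blockDiagonal' fun i => jordanBlockMatrix (p.part i) z) :=
  p.isSimilarMatrix_blockMatrix _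

theorem matrixNullity_jordanMatrix (p : TuplePartition n) (z w : ℂ) (m : ℕ) :
    matrixNullity ((p.jordanMatrix z - w • 1) ^ m) = if z = w then p.nullity m else 0 := by
  rw [(((p.isSimilarMatrix_jordanMatrix z).sub_smul_one w).pow m).matrixNullity_eq,
    matrixNullity_blockDiagonal'_pow]
  split_ifs with h
  · subst h
    exact Finset.sum_congr rfl fun i _ => matrixNullity_jordanBlockMatrix_self _ _ _
  · exact Finset.sum_eq_zero fun i _ => matrixNullity_jordanBlockMatrix_of_ne _ h _

theorem det_jordanMatrix_sub_smul (p : TuplePartition n) (z w : ℂ) :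
    (p.jordanMatrix z - w • 1).det = (z - w) ^ n := by
  rw [((p.isSimilarMatrix_jordanMatrix z).sub_smul_one w).det_eq, det_blockDiagonal'_sub_smul]
  simp only [det_jordanBlockMatrix_sub_smul]
  rw [Finset.prod_pow_eq_pow_sum, p.sum_part]

/-- Two sizes are allowed because blocks of different refined partitions get compared; the sizes
agree because the nullity at large `m` is the size. -/
theorem isSimilarMatrix_jordanMatrix_of_nullity {p : TuplePartition n} {q : TuplePartition n'}
    (h : ∀ m, p.nullity m = q.nullity m) (z : ℂ) :
    IsSimilarMatrix (p.jordanMatrix z) (q.jordanMatrix z) := by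
  obtain rfl : n = n' := by
    rw [← p.nullity_of_le (le_max_left n n'), h, q.nullity_of_le (le_max_right n n')]
  rw [eq_of_nullity_eq h]
  exact IsSimilarMatrix.refl _

end TuplePartition

/-! ### Similarity classes of the matrices `B_ξ(x)`, and disjointness of strata -/

namespace RefinedPartition

variable {n : ℕ}

theorem isSimilarMatrix_jordanMatrix (ξ : RefinedPartition n) (x : Fin ξ.base.length → ℝ) :
    IsSimilarMatrix (ξ.jordanMatrix x)
      (blockDiagonal' fun i => (ξ.sub i).jordanMatrix ((x i : ℂ) * Complex.I)) :=
  ξ.base.isSimilarMatrix_blockMatrix _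

theorem matrixNullity_jordanMatrix (ξ : RefinedPartition n) (x : Fin ξ.base.length → ℝ) (w : ℂ)
    (m : ℕ) : matrixNullity ((ξ.jordanMatrix x - w • 1) ^ m) =
      ∑ i, if (x i : ℂ) * Complex.I = w then (ξ.sub i).nullity m else 0 := by
  rw [(((ξ.isSimilarMatrix_jordanMatrix x).sub_smul_one w).pow m).matrixNullity_eq,
    matrixNullity_blockDiagonal'_pow]
  simp only [TuplePartition.matrixNullity_jordanMatrix]

theorem ofReal_mul_I_inj {a b : ℝ} : (a : ℂ) * Complex.I = (b : ℂ) * Complex.I ↔ a = b := by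
  rw [mul_left_inj' Complex.I_ne_zero, Complex.ofReal_inj]

theorem matrixNullity_jordanMatrix_self (ξ : RefinedPartition n) {x : Fin ξ.base.length → ℝ}
    (hx : Function.Injective x) (i : Fin ξ.base.length) (m : ℕ) :
    matrixNullity ((ξ.jordanMatrix x - ((x i : ℂ) * Complex.I) • 1) ^ m) =
      (ξ.sub i).nullity m := by
  rw [matrixNullity_jordanMatrix]
  simp only [ofReal_mul_I_inj, hx.eq_iff]
  simp

theorem det_jordanMatrix_sub_smul (ξ : RefinedPartition n) (x : Fin ξ.base.length → ℝ) (w : ℂ) :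
    (ξ.jordanMatrix x - w • 1).det = ∏ i, ((x i : ℂ) * Complex.I - w) ^ ξ.base.part i := by
  rw [((ξ.isSimilarMatrix_jordanMatrix x).sub_smul_one w).det_eq, det_blockDiagonal'_sub_smul]
  simp only [TuplePartition.det_jordanMatrix_sub_smul]

theorem mem_spectrum_iff_det {X : Matrix (Fin n) (Fin n) ℂ} {w : ℂ} :
    w ∈ spectrum ℂ X ↔ (X - w • 1).det = 0 := by
  rw [spectrum.mem_iff, ← IsUnit.neg_iff, neg_sub, Algebra.algebraMap_eq_smul_one,
    Matrix.isUnit_iff_isUnit_det, isUnit_iff_ne_zero, not_not]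

theorem mem_spectrum_of_isSimilarMatrix {ξ : RefinedPartition n} {x : Fin ξ.base.length → ℝ}
    {X : Matrix (Fin n) (Fin n) ℂ} (h : IsSimilarMatrix X (ξ.jordanMatrix x)) {w : ℂ} :
    w ∈ spectrum ℂ X ↔ ∃ i, (x i : ℂ) * Complex.I = w := by
  rw [mem_spectrum_iff_det, (h.sub_smul_one w).det_eq, det_jordanMatrix_sub_smul,
    Finset.prod_eq_zero_iff]
  have hp (i) : ξ.base.part i ≠ 0 := Nat.one_le_iff_ne_zero.1 (ξ.base.one_le_part i)
  simp [hp, sub_eq_zero]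

theorem mem_stratum_iff (ξ : RefinedPartition n) {X : Matrix (Fin n) (Fin n) ℂ} :
    X ∈ ξ.stratum ↔ ∃ x, Function.Injective x ∧ IsSimilarMatrix X (ξ.jordanMatrix x) := by
  constructor
  · rintro ⟨A, x, hx, rfl⟩
    exact ⟨x, hx, IsSimilarMatrix.iff_exists_units.2 ⟨A⁻¹, by rw [inv_inv]⟩⟩
  · rintro ⟨x, hx, h⟩
    obtain ⟨g, hg⟩ := IsSimilarMatrix.iff_exists_units.1 h
    exact ⟨g⁻¹, x, hx, by rw [inv_inv]; exact hg⟩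

theorem isSimilarMatrix_of_equiv {ξ η : RefinedPartition n}
    (σ : Fin ξ.base.length ≃ Fin η.base.length) {x : Fin ξ.base.length → ℝ}
    {y : Fin η.base.length → ℝ} (hxy : ∀ i, y (σ i) = x i)
    (hσ : ∀ i m, (ξ.sub i).nullity m = (η.sub (σ i)).nullity m) :
    IsSimilarMatrix (ξ.jordanMatrix x) (η.jordanMatrix y) := by
  refine (ξ.isSimilarMatrix_jordanMatrix x).trans (IsSimilarMatrix.trans ?_
    (η.isSimilarMatrix_jordanMatrix y).symm)
  refine IsSimilarMatrix.trans ?_ (IsSimilarMatrix.blockDiagonal_comp_equiv σ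
    fun j => (η.sub j).jordanMatrix ((y j : ℂ) * Complex.I))
  refine IsSimilarMatrix.blockDiagonal fun i => ?_
  rw [hxy]
  exact TuplePartition.isSimilarMatrix_jordanMatrix_of_nullity (hσ i) _

/-- Equal spectra match the entries of `x` and `y`, and the nullities at each common eigenvalue
match the Jordan types. -/
theorem exists_equiv_of_isSimilarMatrix {ξ η : RefinedPartition n} {x : Fin ξ.base.length → ℝ}
    {y : Fin η.base.length → ℝ} (hx : Function.Injective x) (hy : Function.Injective y)
    (h : IsSimilarMatrix (ξ.jordanMatrix x) (η.jordanMatrix y)) :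
    ∃ σ : Fin ξ.base.length ≃ Fin η.base.length, (∀ i, y (σ i) = x i) ∧
      ∀ i m, (ξ.sub i).nullity m = (η.sub (σ i)).nullity m := by
  have h1 (i) : ∃ j, y j = x i := by
    have := (mem_spectrum_of_isSimilarMatrix (IsSimilarMatrix.refl (ξ.jordanMatrix x))).2 ⟨i, rfl⟩
    simpa only [ofReal_mul_I_inj] using (mem_spectrum_of_isSimilarMatrix h).1 this
  have h2 (j) : ∃ i, x i = y j := by
    have := (mem_spectrum_of_isSimilarMatrix (IsSimilarMatrix.refl (η.jordanMatrix y))).2 ⟨j, rfl⟩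
    simpa only [ofReal_mul_I_inj] using (mem_spectrum_of_isSimilarMatrix h.symm).1 this
  choose σ hσ using h1
  choose τ hτ using h2
  refine ⟨⟨σ, τ, fun i => hx (by rw [hτ, hσ]), fun j => hy (by rw [hσ, hτ])⟩, hσ, fun i m => ?_⟩
  rw [← matrixNullity_jordanMatrix_self ξ hx, ← matrixNullity_jordanMatrix_self η hy]
  simp only [Equiv.coe_fn_mk, hσ]
  exact ((h.sub_smul_one _).pow m).matrixNullity_eq

theorem stratum_subset_of_equiv {ξ η : RefinedPartition n}
    (σ : Fin ξ.base.length ≃ Fin η.base.length)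
    (hσ : ∀ i m, (ξ.sub i).nullity m = (η.sub (σ i)).nullity m) : ξ.stratum ⊆ η.stratum := by
  intro X hX
  rw [mem_stratum_iff] at hX ⊢
  obtain ⟨x, hx, hX⟩ := hX
  exact ⟨x ∘ σ.symm, hx.comp σ.symm.injective,
    hX.trans (isSimilarMatrix_of_equiv σ (by simp) hσ)⟩

/-- Distinct `ξ` can share a stratum, since equal parts `s_i = s_j` may carry their subpartitions in
either order. A common point yields a relabelling that preserves Jordan types, and it applies to
every parameter. -/
theorem stratum_eq_or_disjoint (ξ η : RefinedPartition n) :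
    ξ.stratum = η.stratum ∨ Disjoint ξ.stratum η.stratum := by
  by_cases h : Disjoint ξ.stratum η.stratum
  · exact Or.inr h
  left
  obtain ⟨X, hX, hX'⟩ := Set.not_disjoint_iff.1 h
  obtain ⟨x, hx, hX⟩ := ξ.mem_stratum_iff.1 hX
  obtain ⟨y, hy, hX'⟩ := η.mem_stratum_iff.1 hX'
  obtain ⟨σ, -, hσ⟩ := exists_equiv_of_isSimilarMatrix hx hy (hX.symm.trans hX')
  refine (stratum_subset_of_equiv σ hσ).antisymm (stratum_subset_of_equiv σ.symm fun i m => ?_)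
  rw [hσ (σ.symm i) m, σ.apply_symm_apply]

theorem stratum_nonempty (ξ : RefinedPartition n) : ξ.stratum.Nonempty :=
  ⟨ξ.jordanMatrix fun i => (i : ℕ), ξ.mem_stratum_iff.2
    ⟨_, fun i j h => Fin.ext (by exact_mod_cast h), IsSimilarMatrix.refl _⟩⟩

theorem isSimilarMatrix_mem_stratum (ξ : RefinedPartition n) {X Y : Matrix (Fin n) (Fin n) ℂ}
    (h : IsSimilarMatrix Y X) (hX : X ∈ ξ.stratum) : Y ∈ ξ.stratum := by
  rw [mem_stratum_iff] at hX ⊢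
  obtain ⟨x, hx, hX⟩ := hX
  exact ⟨x, hx, h.trans hX⟩

theorem isConjugacyInvariant_stratum (ξ : RefinedPartition n) :
    IsConjugacyInvariant ξ.stratum := fun A X hX =>
  ξ.isSimilarMatrix_mem_stratum (IsSimilarMatrix.iff_exists_units.2 ⟨A⁻¹, by rw [inv_inv]⟩) hX

end RefinedPartition

/-! ### Dimensions of centralizers and semicontinuity of nullity -/

section Intertwiner

variable {m n : Type*} [Fintype m] [Fintype n] [DecidableEq m] [DecidableEq n]

theorem IsSimilarMatrix.finrank_intertwiner_le {A : Matrix m m ℂ} {B : Matrix n n ℂ}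
    (h : IsSimilarMatrix A B) :
    Module.finrank ℂ (intertwiner A A) ≤ Module.finrank ℂ (intertwiner B B) := by
  obtain ⟨P, Q, hPQ, hQP, rfl⟩ := h
  let f : Matrix m m ℂ →ₗ[ℂ] Matrix n n ℂ :=
    { toFun := fun Z => Q * Z * P
      map_add' := fun Y Z => by rw [Matrix.mul_add, Matrix.add_mul]
      map_smul' := fun c Z => by simp }
  have hf (Z : Matrix m m ℂ) : P * f Z * Q = Z := by
    simp only [f, LinearMap.coe_mk, AddHom.coe_mk]
    rw [← Matrix.mul_assoc, ← Matrix.mul_assoc, hPQ, Matrix.one_mul, Matrix.mul_assoc, hPQ,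
      Matrix.mul_one]
  refine LinearMap.finrank_le_finrank_of_injective
    (f := f.restrict (p := intertwiner (P * B * Q) (P * B * Q)) fun Z hZ => ?_) ?_
  · rw [mem_intertwiner] at hZ ⊢
    have h := congrArg (fun Y => Q * Y * P) hZ
    simp only [f, LinearMap.coe_mk, AddHom.coe_mk]
    calc B * (Q * Z * P) = Q * (P * B * Q * Z) * P := by
          simp only [← Matrix.mul_assoc, hQP, Matrix.one_mul]
      _ = Q * (Z * (P * B * Q)) * P := h
      _ = Q * Z * P * B := by simp only [Matrix.mul_assoc, hQP, Matrix.mul_one]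
  · intro Y Z hYZ
    have h : f Y.1 = f Z.1 := congrArg Subtype.val hYZ
    exact Subtype.ext (by rw [← hf Y, h, hf])

theorem IsSimilarMatrix.finrank_intertwiner_eq {A : Matrix m m ℂ} {B : Matrix n n ℂ}
    (h : IsSimilarMatrix A B) :
    Module.finrank ℂ (intertwiner A A) = Module.finrank ℂ (intertwiner B B) :=
  h.finrank_intertwiner_le.antisymm h.symm.finrank_intertwiner_le

theorem sum_finrank_intertwiner_le {o : Type*} [Fintype o] [DecidableEq o] {m : o → Type*}
    [∀ i, Fintype (m i)] [∀ i, DecidableEq (m i)] (A : ∀ i, Matrix (m i) (m i) ℂ) :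
    ∑ i, Module.finrank ℂ (intertwiner (A i) (A i)) ≤
      Module.finrank ℂ (intertwiner (blockDiagonal' A) (blockDiagonal' A)) := by
  rw [← Module.finrank_pi_fintype]
  let f : (∀ i, intertwiner (A i) (A i)) →ₗ[ℂ]
      intertwiner (blockDiagonal' A) (blockDiagonal' A) :=
    { toFun := fun Z => ⟨blockDiagonal' fun i => (Z i).1, by
        rw [mem_intertwiner, ← blockDiagonal'_mul, ← blockDiagonal'_mul]
        congr 1
        funext i
        exact (Z i).2⟩
      map_add' := fun Y Z => Subtype.ext
        (blockDiagonal'_add (fun i => (Y i).1) fun i => (Z i).1)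
      map_smul' := fun c Z => Subtype.ext (blockDiagonal'_smul c fun i => (Z i).1) }
  refine LinearMap.finrank_le_finrank_of_injective (f := f) fun Y Z h => ?_
  have h' : (fun i => (Y i).1) = fun i => (Z i).1 :=
    blockDiagonal'_injective (congrArg Subtype.val h)
  funext i
  exact Subtype.ext (congrFun h' i)

/-- The powers `N ^ l` with `l < s` commute with the block and are independent: the first row of a
combination lists its coefficients. -/
theorem le_finrank_intertwiner_jordanBlockMatrix (s : ℕ) (z : ℂ) :
    s ≤ Module.finrank ℂ (intertwiner (jordanBlockMatrix s z) (jordanBlockMatrix s z)) := by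
  let N := jordanBlockMatrix s z - z • 1
  have hN : jordanBlockMatrix s z = N + z • 1 := by simp [N]
  let f : (Fin s → ℂ) →ₗ[ℂ] Matrix (Fin s) (Fin s) ℂ :=
    Fintype.linearCombination ℂ fun l : Fin s => N ^ (l : ℕ)
  have hf (c : Fin s → ℂ) : f c ∈ intertwiner (jordanBlockMatrix s z) (jordanBlockMatrix s z) := by
    simp only [f, Fintype.linearCombination_apply]
    refine Submodule.sum_mem _ fun l _ => Submodule.smul_mem _ _ ?_
    rw [mem_intertwiner, hN]
    exact (((Commute.refl N).add_left ((Commute.one_left N).smul_left z)).pow_right _)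
  have hle := LinearMap.finrank_le_finrank_of_injective (f := f.codRestrict _ hf) fun c d h => ?_
  · simpa using hle
  · have h' : f c = f d := congrArg Subtype.val h
    funext j
    have hs : 0 < s := j.pos
    have happ (c : Fin s → ℂ) : f c ⟨0, hs⟩ j = c j := by
      simp only [f, Fintype.linearCombination_apply, Matrix.sum_apply, Matrix.smul_apply, N,
        jordanBlockMatrix_sub_smul_pow_apply]
      simp [← Fin.ext_iff]
    rw [← happ c, h', happ]

/-- The kernel dimension of a matrix is upper semicontinuous. -/
theorem eventually_matrixNullity_le (A₀ : Matrix n n ℂ) :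
    ∀ᶠ A in 𝓝 A₀, matrixNullity A ≤ matrixNullity A₀ := by
  let Λ : Matrix n n ℂ →ₗ[ℂ] ((n → ℂ) →L[ℂ] (n → ℂ)) :=
    (LinearMap.toContinuousLinearMap.toLinearMap).comp (Matrix.toLin' (R := ℂ)).toLinearMap
  have hΛ : Continuous Λ := Λ.continuous_of_finiteDimensional
  have hrank (A : Matrix n n ℂ) :
      ((Λ A : (n → ℂ) →L[ℂ] (n → ℂ)) : (n → ℂ) →ₗ[ℂ] (n → ℂ)).rank = (A.rank : Cardinal) :=
    (Module.finrank_eq_rank _ _).symm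
  -- Rank is lower semicontinuous, and nullity is its complement to the fixed size.
  have hopen := (isOpen_setOfPred_nat_le_rank (𝕜 := ℂ) (E := n → ℂ)
    (F := n → ℂ) A₀.rank).preimage hΛ
  filter_upwards [hopen.mem_nhds (show _ ≤ _ from (hrank A₀).ge)] with A hA
  have hA' : A₀.rank ≤ A.rank := by
    have : (A₀.rank : Cardinal) ≤ (A.rank : Cardinal) := (hrank A) ▸ hA
    exact_mod_cast this
  have h1 := matrixNullity_add_rank A
  have h2 := matrixNullity_add_rank A₀
  omega

/-- Here `f` is an idempotent and `r'` inverts `r` in its corner. What commutes with `r` then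
commutes with `f`, since both products equal `f * a * f`. -/
theorem commute_of_mul_eq {R : Type*} [Ring R] {a r r' f : R} (h : a * r = r * a)
    (hf : r * r' = f) (hf' : r' * r = f) (hr : r * f = r) (hr' : f * r = r) :
    a * f = f * a := by
  have h1 : a * f = f * a * f := by
    calc a * f = a * r * r' := by rw [← hf, mul_assoc]
      _ = r * a * r' := by rw [h]
      _ = f * (r * a) * r' := by rw [← mul_assoc f, hr']
      _ = f * a * (r * r') := by rw [← h]; simp only [mul_assoc]
      _ = f * a * f := by rw [hf]
  have h2 : f * a = f * a * f := by
    calc f * a = r' * (r * a) := by rw [← hf', mul_assoc]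
      _ = r' * (a * (r * f)) := by rw [← h, hr]
      _ = r' * r * a * f := by rw [← mul_assoc a, h]; simp only [mul_assoc]
      _ = f * a * f := by rw [hf']
  rw [h1, ← h2]

end Intertwiner

namespace TuplePartition

variable {n : ℕ}

theorem le_finrank_intertwiner (p : TuplePartition n) (z : ℂ) :
    n ≤ Module.finrank ℂ (intertwiner (p.jordanMatrix z) (p.jordanMatrix z)) := by
  rw [(p.isSimilarMatrix_jordanMatrix z).finrank_intertwiner_eq]
  refine le_trans ?_ (sum_finrank_intertwiner_le _)
  conv_lhs => rw [← p.sum_part]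
  exact Finset.sum_le_sum fun i _ => le_finrank_intertwiner_jordanBlockMatrix _ _

theorem jordanMatrix_eq_add (p : TuplePartition n) (z : ℂ) :
    p.jordanMatrix z = p.jordanMatrix 0 + z • 1 := by
  have h (s : ℕ) : jordanBlockMatrix s z = jordanBlockMatrix s 0 + z • 1 := by
    ext i j
    by_cases hij : i = j
    · subst hij; simp [jordanBlockMatrix]
    · simp [jordanBlockMatrix, hij]
  simp only [TuplePartition.jordanMatrix, TuplePartition.blockMatrix, h]
  have h2 : blockDiagonal' (fun i => jordanBlockMatrix (p.part i) 0 + z • 1) =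
      blockDiagonal' (fun i => jordanBlockMatrix (p.part i) 0) + z • 1 := by
    rw [← blockDiagonal'_one, ← blockDiagonal'_smul, ← blockDiagonal'_add]
    rfl
  rw [h2]
  simp only [Matrix.reindex_apply, Matrix.submatrix_add, Matrix.submatrix_smul, Pi.add_apply,
    Pi.smul_apply, Matrix.submatrix_one_equiv]

theorem jordanMatrix_sub_smul_pow_eq_zero (p : TuplePartition n) (z : ℂ) {m : ℕ} (h : n ≤ m) :
    (p.jordanMatrix z - z • 1) ^ m = 0 := by
  have h1 := p.matrixNullity_jordanMatrix z z m
  rw [if_pos rfl, p.nullity_of_le h] at h1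
  have h2 : LinearMap.ker ((p.jordanMatrix z - z • 1) ^ m).mulVecLin = ⊤ :=
    Submodule.eq_top_of_finrank_eq (by rw [Module.finrank_fin_fun]; exact h1)
  rw [LinearMap.ker_eq_top] at h2
  exact Matrix.toLin'.injective (by rw [Matrix.toLin'_apply', h2, map_zero])

end TuplePartition

/-! ### The centralizer is constant along a stratum -/

namespace RefinedPartition

variable {n : ℕ} (ξ : RefinedPartition n)

/-- The matrix `B_ξ(x)`, indexed by the blocks. -/
noncomputable def blockJordan (x : Fin ξ.base.length → ℝ) :
    Matrix (Σ i, Fin (ξ.base.part i)) (Σ i, Fin (ξ.base.part i)) ℂ :=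
  blockDiagonal' fun i => (ξ.sub i).jordanMatrix ((x i : ℂ) * Complex.I)

/-- The projection to a block. -/
noncomputable def blockProj (i : Fin ξ.base.length) :
    Matrix (Σ i, Fin (ξ.base.part i)) (Σ i, Fin (ξ.base.part i)) ℂ :=
  blockDiagonal' (Pi.single i 1)

theorem blockJordan_eq (x : Fin ξ.base.length → ℝ) :
    ξ.blockJordan x = ξ.blockJordan 0 + ∑ i, x i • (Complex.I • ξ.blockProj i) := by
  have h : ∑ i, x i • (Complex.I • ξ.blockProj i) =
      blockDiagonal' fun i => ((x i : ℂ) * Complex.I) • (1 : Matrix (Fin (ξ.base.part i)) _ ℂ) := by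
    ext ⟨i, a⟩ ⟨j, b⟩
    simp only [Matrix.sum_apply, Matrix.smul_apply, blockProj]
    by_cases hij : i = j
    · subst hij
      simp only [blockDiagonal'_apply_eq]
      rw [Finset.sum_eq_single i]
      · simp [mul_assoc]
      · intro k _ hk
        simp [Pi.single_eq_of_ne hk.symm]
      · simp
    · simp [blockDiagonal'_apply_ne _ _ _ hij]
  rw [h, blockJordan, blockJordan, ← blockDiagonal'_add]
  congr 1
  funext i
  simp [(ξ.sub i).jordanMatrix_eq_add ((x i : ℂ) * Complex.I)]

theorem blockJordan_mul_blockProj (x : Fin ξ.base.length → ℝ) (i : Fin ξ.base.length) :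
    ξ.blockJordan x * ξ.blockProj i = ξ.blockProj i * ξ.blockJordan x := by
  rw [blockJordan, blockProj, ← blockDiagonal'_mul, ← blockDiagonal'_mul]
  congr 1
  funext j
  by_cases h : j = i
  · subst h; simp
  · simp [Pi.single_eq_of_ne h]

theorem blockProj_mul_blockProj_of_ne {i j : Fin ξ.base.length} (hij : i ≠ j) :
    ξ.blockProj i * ξ.blockProj j = 0 := by
  rw [blockProj, blockProj, ← blockDiagonal'_mul, ← blockDiagonal'_zero]
  congr 1
  funext k
  by_cases h : k = i
  · subst h; simp [Pi.single_eq_of_ne hij]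
  · simp [Pi.single_eq_of_ne h]

theorem trace_blockProj_mul_self (i : Fin ξ.base.length) :
    (ξ.blockProj i * ξ.blockProj i).trace = ξ.base.part i := by
  rw [blockProj, ← blockDiagonal'_mul, trace_blockDiagonal', Finset.sum_eq_single i]
  · simp
  · intro j _ hj
    simp [Pi.single_eq_of_ne hj]
  · simp

/-- The power `(B - x_i I)^n` vanishes on block `i` and is invertible on every other block, so `1 -
blockProj i` is its corner idempotent and `commute_of_mul_eq` applies. -/
theorem blockProj_comm_of_mem_intertwiner {x : Fin ξ.base.length → ℝ}
    (hx : Function.Injective x)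
    {A : Matrix (Σ i, Fin (ξ.base.part i)) (Σ i, Fin (ξ.base.part i)) ℂ}
    (hA : A ∈ intertwiner (ξ.blockJordan x) (ξ.blockJordan x)) (i : Fin ξ.base.length) :
    A * ξ.blockProj i = ξ.blockProj i * A := by
  set lam : ℂ := (x i : ℂ) * Complex.I with hlam
  let J : ∀ j, Matrix (Fin (ξ.base.part j)) (Fin (ξ.base.part j)) ℂ :=
    fun j => (ξ.sub j).jordanMatrix ((x j : ℂ) * Complex.I)
  let r : ∀ j, Matrix (Fin (ξ.base.part j)) (Fin (ξ.base.part j)) ℂ :=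
    fun j => (J j - lam • 1) ^ n
  have hr : (ξ.blockJordan x - lam • 1) ^ n = blockDiagonal' r := by
    change _ = blockDiagonal' ((J - lam • 1) ^ n)
    rw [blockDiagonal'_pow, blockDiagonal'_sub, blockDiagonal'_smul, blockDiagonal'_one]
    rfl
  have hri : r i = 0 := (ξ.sub i).jordanMatrix_sub_smul_pow_eq_zero _ (ξ.base.part_le i)
  have hrj (j) (hj : j ≠ i) : IsUnit (r j).det := by
    rw [← Matrix.isUnit_iff_isUnit_det, ← matrixNullity_eq_zero_iff,
      TuplePartition.matrixNullity_jordanMatrix, if_neg]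
    rw [hlam, ofReal_mul_I_inj, hx.eq_iff]
    exact hj
  let r' : ∀ j, Matrix (Fin (ξ.base.part j)) (Fin (ξ.base.part j)) ℂ :=
    fun j => if j = i then 0 else (r j)⁻¹
  have hproj : (1 : Matrix (Σ i, Fin (ξ.base.part i)) (Σ i, Fin (ξ.base.part i)) ℂ) -
      ξ.blockProj i = blockDiagonal' (1 - Pi.single i 1) := by
    rw [blockProj, blockDiagonal'_sub, blockDiagonal'_one]
  have hcomm : A * (1 - ξ.blockProj i) = (1 - ξ.blockProj i) * A := by
    refine commute_of_mul_eq (r := blockDiagonal' r) (r' := blockDiagonal' r') ?_ ?_ ?_ ?_ ?_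
    · rw [← hr]
      have hA' : Commute A (ξ.blockJordan x) := (mem_intertwiner.1 hA).symm
      exact (hA'.sub_right ((Commute.one_right A).smul_right lam)).pow_right n
    all_goals
      rw [hproj, ← blockDiagonal'_mul]
      congr 1
      funext j
      by_cases hj : j = i
      · subst hj
        simp [hri, r']
      · simp [r', hj, Matrix.mul_nonsing_inv _ (hrj j hj),
          Matrix.nonsing_inv_mul _ (hrj j hj)]
  rw [mul_sub, sub_mul, mul_one, one_mul] at hcomm
  exact sub_right_injective hcomm

/-- Changing the parameter adds a combination of block projections, with which the centralizer at an
injective `x` commutes. For two injective parameters this gives equality. -/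
theorem intertwiner_blockJordan_le {x y : Fin ξ.base.length → ℝ} (hx : Function.Injective x) :
    intertwiner (ξ.blockJordan x) (ξ.blockJordan x) ≤
      intertwiner (ξ.blockJordan y) (ξ.blockJordan y) := by
  intro A hA
  have hx' := mem_intertwiner.1 hA
  rw [mem_intertwiner]
  have h : ξ.blockJordan y = ξ.blockJordan x + ∑ i, (y i - x i) • (Complex.I • ξ.blockProj i) := by
    rw [ξ.blockJordan_eq y, ξ.blockJordan_eq x]
    simp [sub_smul]
  rw [h, add_mul, mul_add, hx', Finset.sum_mul, Finset.mul_sum]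
  congr 1
  refine Finset.sum_congr rfl fun i _ => ?_
  rw [Matrix.smul_mul, Matrix.smul_mul, Matrix.mul_smul, Matrix.mul_smul,
    ξ.blockProj_comm_of_mem_intertwiner hx hA]

/-- The complex dimension of the centralizer of the matrices in a stratum. -/
noncomputable def centralizerDim : ℕ :=
  Module.finrank ℂ (intertwiner (ξ.blockJordan fun i => (i : ℕ)) (ξ.blockJordan fun i => (i : ℕ)))

theorem finrank_intertwiner_blockJordan {x : Fin ξ.base.length → ℝ} (hx : Function.Injective x) :
    Module.finrank ℂ (intertwiner (ξ.blockJordan x) (ξ.blockJordan x)) = ξ.centralizerDim :=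
  (Submodule.finrank_mono (ξ.intertwiner_blockJordan_le hx)).antisymm
    (Submodule.finrank_mono (ξ.intertwiner_blockJordan_le
      (Nat.cast_injective.comp Fin.val_injective)))

theorem le_centralizerDim : n ≤ ξ.centralizerDim := by
  refine le_trans ?_ (sum_finrank_intertwiner_le _)
  conv_lhs => rw [← ξ.base.sum_part]
  exact Finset.sum_le_sum fun i _ => (ξ.sub i).le_finrank_intertwiner _

/-- Commuting with the block projections forces block diagonal form, so an element of the
centralizer is determined by its diagonal blocks. -/
theorem centralizerDim_le : ξ.centralizerDim ≤ ∑ i, ξ.base.part i ^ 2 := by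
  have hx : Function.Injective fun i : Fin ξ.base.length => ((i : ℕ) : ℝ) :=
    Nat.cast_injective.comp Fin.val_injective
  let f : Matrix (Σ i, Fin (ξ.base.part i)) (Σ i, Fin (ξ.base.part i)) ℂ →ₗ[ℂ]
      ∀ i, Matrix (Fin (ξ.base.part i)) (Fin (ξ.base.part i)) ℂ :=
    { toFun := blockDiag'
      map_add' := blockDiag'_add
      map_smul' := blockDiag'_smul }
  have hle := LinearMap.finrank_le_finrank_of_injective
    (f := f.domRestrict (intertwiner (ξ.blockJordan fun i => (i : ℕ))
      (ξ.blockJordan fun i => (i : ℕ)))) fun A B h => ?_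
  · refine hle.trans_eq ?_
    rw [Module.finrank_pi_fintype]
    refine Finset.sum_congr rfl fun i _ => ?_
    simp [Module.finrank_matrix, pow_two]
  · have h' : blockDiag' A.1 = blockDiag' B.1 := h
    have hoff (A : intertwiner (ξ.blockJordan fun i => (i : ℕ)) (ξ.blockJordan fun i => (i : ℕ)))
        {i j} (hij : i ≠ j) (a b) : A.1 ⟨i, a⟩ ⟨j, b⟩ = 0 := by
      have h1 := congrFun (congrFun (ξ.blockProj_comm_of_mem_intertwiner hx A.2 j) ⟨i, a⟩) ⟨j, b⟩
      have hd : ξ.blockProj j = diagonal fun k => if k.1 = j then 1 else 0 := by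
        ext ⟨k, c⟩ ⟨l, d⟩
        by_cases hkl : k = l
        · subst hkl
          rw [blockProj, blockDiagonal'_apply_eq]
          by_cases hk : k = j
          · subst hk; simp [Matrix.one_apply, diagonal_apply]
          · simp [hk, diagonal_apply]
        · rw [blockProj, blockDiagonal'_apply_ne _ _ _ hkl, diagonal_apply_ne]
          intro h; exact hkl (congrArg Sigma.fst h)
      rw [hd, mul_diagonal, diagonal_mul] at h1
      simpa [hij] using h1
    refine Subtype.ext (Matrix.ext fun a b => ?_)
    obtain ⟨i, a⟩ := a
    obtain ⟨j, b⟩ := b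
    by_cases hij : i = j
    · subst hij
      exact congrFun (congrFun (congrFun h' i) a) b
    · rw [hoff A hij, hoff B hij]

end RefinedPartition

/-! ### Convergence within a stratum, its charts and its dimension -/

namespace RefinedPartition

variable {n : ℕ} (ξ : RefinedPartition n)

/-- This bound makes the parameters near a given matrix relatively compact. The factor `‖1‖` covers
`n = 0`, where the norm of `1` is `0`. -/
theorem norm_le_of_isSimilarMatrix {x : Fin ξ.base.length → ℝ} {X : Matrix (Fin n) (Fin n) ℂ}
    (h : IsSimilarMatrix X (ξ.jordanMatrix x)) :
    ‖x‖ ≤ ‖X‖ * ‖(1 : Matrix (Fin n) (Fin n) ℂ)‖ := by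
  refine (pi_norm_le_iff_of_nonneg (by positivity)).2 fun i => ?_
  have := spectrum.norm_le_norm_mul_of_mem ((mem_spectrum_of_isSimilarMatrix h).2 ⟨i, rfl⟩)
  simpa using this

/-- The limit of parameters of matrices in a stratum that converge within the stratum is, up to
a permutation that preserves the Jordan type, the parameter of the limit. -/
theorem exists_perm_of_tendsto {α : Type*} {l : Filter α} [l.NeBot]
    {X : α → Matrix (Fin n) (Fin n) ℂ} {y : α → Fin ξ.base.length → ℝ}
    {x₀ y₀ : Fin ξ.base.length → ℝ} {X₀ : Matrix (Fin n) (Fin n) ℂ}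
    (hx₀ : Function.Injective x₀) (hX₀ : IsSimilarMatrix X₀ (ξ.jordanMatrix x₀))
    (hy : ∀ᶠ a in l, Function.Injective (y a))
    (hX : ∀ᶠ a in l, IsSimilarMatrix (X a) (ξ.jordanMatrix (y a)))
    (hlim : Tendsto X l (𝓝 X₀)) (hlim' : Tendsto y l (𝓝 y₀)) :
    ∃ σ : Equiv.Perm (Fin ξ.base.length), y₀ ∘ σ = x₀ ∧
      ∀ i m, (ξ.sub i).nullity m = (ξ.sub (σ i)).nullity m := by
  -- The characteristic polynomials converge, so `x₀` and `y₀` give the same one; its roots show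
  -- that each `x₀ i` occurs among the `y₀ j`. Injectivity of `x₀` makes the matching a permutation.
  have hdet (w : ℂ) : ∏ i, ((x₀ i : ℂ) * Complex.I - w) ^ ξ.base.part i =
      ∏ i, ((y₀ i : ℂ) * Complex.I - w) ^ ξ.base.part i := by
    have h1 : Tendsto (fun a => (X a - w • 1).det) l (𝓝 (X₀ - w • 1).det) := by
      have : Continuous fun X : Matrix (Fin n) (Fin n) ℂ => (X - w • 1).det := by fun_prop
      exact (this.tendsto X₀).comp hlim
    have h2 : Tendsto (fun a => ∏ i, ((y a i : ℂ) * Complex.I - w) ^ ξ.base.part i) l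
        (𝓝 (∏ i, ((y₀ i : ℂ) * Complex.I - w) ^ ξ.base.part i)) := by
      have : Continuous fun y : Fin ξ.base.length → ℝ =>
        ∏ i, ((y i : ℂ) * Complex.I - w) ^ ξ.base.part i := by fun_prop
      exact (this.tendsto y₀).comp hlim'
    rw [← det_jordanMatrix_sub_smul, ← (hX₀.sub_smul_one w).det_eq]
    refine tendsto_nhds_unique h1 (h2.congr' ?_)
    filter_upwards [hX] with a ha
    rw [(ha.sub_smul_one w).det_eq, det_jordanMatrix_sub_smul]
  have hp (i) : ξ.base.part i ≠ 0 := Nat.one_le_iff_ne_zero.1 (ξ.base.one_le_part i)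
  have hex (i) : ∃ j, y₀ j = x₀ i := by
    have h := hdet ((x₀ i : ℂ) * Complex.I)
    rw [Finset.prod_eq_zero (Finset.mem_univ i) (by simp [hp]), eq_comm,
      Finset.prod_eq_zero_iff] at h
    obtain ⟨j, -, hj⟩ := h
    exact ⟨j, ofReal_mul_I_inj.1 (sub_eq_zero.1 (eq_zero_of_pow_eq_zero hj))⟩
  choose ρ hρ using hex
  have hρinj : Function.Injective ρ := fun i j h => hx₀ (by rw [← hρ, ← hρ, h])
  let σ : Equiv.Perm (Fin ξ.base.length) :=
    Equiv.ofBijective ρ (Finite.injective_iff_bijective.1 hρinj)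
  have hσ (i) : y₀ (σ i) = x₀ i := hρ i
  refine ⟨σ, funext hσ, ?_⟩
  -- Nullity can only jump up in the limit. As `σ` merely permutes the terms, both sides have the
  -- same sum over `i`, so every inequality is an equality.
  have hle (m i) : (ξ.sub (σ i)).nullity m ≤ (ξ.sub i).nullity m := by
    have h1 : Tendsto (fun a => (X a - ((y a (σ i) : ℂ) * Complex.I) • 1) ^ m) l
        (𝓝 ((X₀ - ((x₀ i : ℂ) * Complex.I) • 1) ^ m)) := by
      have hyi : Tendsto (fun a => (((y a (σ i) : ℂ) * Complex.I) •
          (1 : Matrix (Fin n) (Fin n) ℂ))) l (𝓝 (((x₀ i : ℂ) * Complex.I) • 1)) := by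
        rw [← hσ]
        have : Continuous fun y : Fin ξ.base.length → ℝ =>
          (((y (σ i) : ℂ) * Complex.I) • (1 : Matrix (Fin n) (Fin n) ℂ)) := by fun_prop
        exact (this.tendsto y₀).comp hlim'
      exact (hlim.sub hyi).pow m
    obtain ⟨a, ha1, ha2, ha3⟩ :=
      ((h1.eventually (eventually_matrixNullity_le _)).and (hy.and hX)).exists
    rwa [((ha3.sub_smul_one _).pow m).matrixNullity_eq,
      ((hX₀.sub_smul_one _).pow m).matrixNullity_eq, matrixNullity_jordanMatrix_self _ ha2,
      matrixNullity_jordanMatrix_self _ hx₀] at ha1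
  intro i m
  have hsum : ∑ i, (ξ.sub (σ i)).nullity m = ∑ i, (ξ.sub i).nullity m :=
    Equiv.sum_comp σ fun i => (ξ.sub i).nullity m
  exact ((Finset.sum_eq_sum_iff_of_le fun i _ => hle m i).1 hsum i (Finset.mem_univ i)).symm

/-- Along an ultrafilter the bounded parameters converge to some `y₀`. By `exists_perm_of_tendsto`
it is a permutation of `x₀` that preserves Jordan types, so permuted parameters describe the same
matrices and converge to `x₀`. -/
theorem eventually_exists_param_near {x₀ : Fin ξ.base.length → ℝ} (hx₀ : Function.Injective x₀)
    {X₀ : Matrix (Fin n) (Fin n) ℂ} (hX₀ : IsSimilarMatrix X₀ (ξ.jordanMatrix x₀))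
    {W : Set (Fin ξ.base.length → ℝ)} (hW : W ∈ 𝓝 x₀) :
    ∀ᶠ X in 𝓝[ξ.stratum] X₀, ∃ x ∈ W, IsSimilarMatrix X (ξ.jordanMatrix x) := by
  have hex (X : Matrix (Fin n) (Fin n) ℂ) : ∃ y, X ∈ ξ.stratum →
      Function.Injective y ∧ IsSimilarMatrix X (ξ.jordanMatrix y) := by
    by_cases h : X ∈ ξ.stratum
    · obtain ⟨y, hy⟩ := ξ.mem_stratum_iff.1 h
      exact ⟨y, fun _ => hy⟩
    · exact ⟨0, fun h' => absurd h' h⟩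
  choose y hy using hex
  refine Filter.mem_iff_ultrafilter.2 fun U hU => ?_
  have hUS : ∀ᶠ X in (U : Filter (Matrix (Fin n) (Fin n) ℂ)), X ∈ ξ.stratum :=
    hU self_mem_nhdsWithin
  have hUX : Tendsto (fun X => X) (U : Filter (Matrix (Fin n) (Fin n) ℂ)) (𝓝 X₀) :=
    hU.trans nhdsWithin_le_nhds
  set R : ℝ := (‖X₀‖ + 1) * ‖(1 : Matrix (Fin n) (Fin n) ℂ)‖ with hR
  have hbdd : ∀ᶠ X in (U : Filter (Matrix (Fin n) (Fin n) ℂ)), y X ∈ Metric.closedBall 0 R := by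
    have hn : ∀ᶠ X in (U : Filter (Matrix (Fin n) (Fin n) ℂ)), ‖X‖ < ‖X₀‖ + 1 :=
      hUX.norm.eventually_lt_const (by linarith)
    filter_upwards [hUS, hn] with X hX hXn
    rw [mem_closedBall_zero_iff]
    exact (ξ.norm_le_of_isSimilarMatrix (hy X hX).2).trans
      (mul_le_mul_of_nonneg_right hXn.le (norm_nonneg _))
  obtain ⟨y₀, -, hy₀⟩ := (isCompact_closedBall (0 : Fin ξ.base.length → ℝ) R).ultrafilter_le_nhds
    (U.map y) (le_principal_iff.2 hbdd)
  have hlim : Tendsto y U (𝓝 y₀) := hy₀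
  obtain ⟨σ, hσ, hnul⟩ := ξ.exists_perm_of_tendsto hx₀ hX₀
    (hUS.mono fun X hX => (hy X hX).1) (hUS.mono fun X hX => (hy X hX).2) hUX hlim
  have hlim' : Tendsto (fun X => y X ∘ σ) U (𝓝 x₀) := by
    rw [← hσ]
    have : Continuous fun y : Fin ξ.base.length → ℝ => y ∘ σ := by fun_prop
    exact (this.tendsto y₀).comp hlim
  filter_upwards [hUS, hlim'.eventually hW] with X hX hXW
  exact ⟨y X ∘ σ, hXW, (hy X hX).2.trans (isSimilarMatrix_of_equiv σ (fun _ => rfl) hnul).symm⟩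

/-- The affine family is `B_ξ(x)` transported by a fixed similarity to pass through `X₀`; the
spectral projections play the role of the `P i`, with trace of the square `s_i ≠ 0`. -/
theorem isEmbeddedSubmanifold_stratum :
    IsEmbeddedSubmanifold ξ.stratum (ξ.base.length + 2 * (n ^ 2 - ξ.centralizerDim)) := by
  intro X₀ hX₀
  obtain ⟨x₀, hx₀, hsim⟩ := ξ.mem_stratum_iff.1 hX₀
  obtain ⟨P, Q, hPQ, hQP, hX⟩ := hsim.trans (ξ.isSimilarMatrix_jordanMatrix x₀)
  let C : (Fin ξ.base.length → ℝ) → Matrix (Fin n) (Fin n) ℂ := fun x => P * ξ.blockJordan x * Q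
  let E : Fin ξ.base.length → Matrix (Fin n) (Fin n) ℂ := fun i => P * ξ.blockProj i * Q
  have hsimC (x) : IsSimilarMatrix (C x) (ξ.blockJordan x) := ⟨P, Q, hPQ, hQP, rfl⟩
  have hsimC' (x) : IsSimilarMatrix (C x) (ξ.jordanMatrix x) :=
    (hsimC x).trans (ξ.isSimilarMatrix_jordanMatrix x).symm
  have hrank {x} (hx : Function.Injective x) :
      Module.finrank ℂ (intertwiner (C x) (C x)) = ξ.centralizerDim := by
    rw [(hsimC x).finrank_intertwiner_eq, ξ.finrank_intertwiner_blockJordan hx]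
  have hinj : ∀ᶠ x in 𝓝 x₀, Function.Injective x := by
    have : ∀ i j, ∀ᶠ x : Fin ξ.base.length → ℝ in 𝓝 x₀, i ≠ j → x i ≠ x j := by
      intro i j
      by_cases hij : i = j
      · simp [hij]
      · have ho : IsOpen {x : Fin ξ.base.length → ℝ | x i ≠ x j} :=
          isOpen_ne_fun (continuous_apply i) (continuous_apply j)
        filter_upwards [ho.mem_nhds (hx₀.ne hij)] with x hx _ using hx
    filter_upwards [eventually_all.2 fun i => eventually_all.2 (this i)] with x hx i j h
    by_contra hij
    exact hx i j hij h
  have hEE (i j) : E i * E j = P * (ξ.blockProj i * ξ.blockProj j) * Q :=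
    conj_mul_conj_of_mul_eq_one hQP rfl rfl
  have htr (M : Matrix (Σ i, Fin (ξ.base.part i)) (Σ i, Fin (ξ.base.part i)) ℂ) :
      (P * M * Q).trace = M.trace := by
    rw [Matrix.trace_mul_comm, ← Matrix.mul_assoc, hQP, Matrix.one_mul]
  have hCx₀ : C x₀ = X₀ := hX.symm
  have hdim : Fintype.card (Fin ξ.base.length) + 2 * (Fintype.card (Fin n) ^ 2 -
      Module.finrank ℂ (intertwiner (C x₀) (C x₀))) =
      ξ.base.length + 2 * (n ^ 2 - ξ.centralizerDim) := by
    rw [hrank hx₀, Fintype.card_fin, Fintype.card_fin]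
  rw [← hdim, ← hCx₀]
  refine exists_chart_of_conjugation (C := C) (M := C 0) (P := E) ?_ ?_ ?_ ?_ ?_ ?_ ?_
  · intro x
    simp only [C, E]
    rw [ξ.blockJordan_eq x]
    simp only [Matrix.mul_add, Matrix.add_mul, Matrix.mul_sum, Matrix.sum_mul, Matrix.mul_smul,
      Matrix.smul_mul]
  · intro i
    rw [conj_mul_conj_of_mul_eq_one hQP (A := C x₀) (A' := E i) rfl rfl,
      conj_mul_conj_of_mul_eq_one hQP (A := E i) (A' := C x₀) rfl rfl,
      ξ.blockJordan_mul_blockProj]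
  · intro i j hij
    rw [hEE, htr, ξ.blockProj_mul_blockProj_of_ne hij, Matrix.trace_zero]
  · intro i
    rw [hEE, htr, ξ.trace_blockProj_mul_self, Nat.cast_ne_zero]
    exact Nat.one_le_iff_ne_zero.1 (ξ.base.one_le_part i)
  · filter_upwards [hinj] with x hx
    rw [hrank hx, hrank hx₀]
  · filter_upwards [hinj] with x hx g
    exact ξ.mem_stratum_iff.2 ⟨x, hx,
      (IsSimilarMatrix.iff_exists_units.2 ⟨g, rfl⟩).trans (hsimC' x)⟩
  · intro W hW
    rw [hCx₀]
    filter_upwards [ξ.eventually_exists_param_near hx₀ hsim hW] with X hX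
    obtain ⟨x, hxW, hx⟩ := hX
    exact ⟨x, hxW, IsSimilarMatrix.iff_exists_units.1 (hx.trans (hsimC' x).symm)⟩

/-- The real dimension of a stratum. -/
noncomputable def stratumDim : ℕ := ξ.base.length + 2 * (n ^ 2 - ξ.centralizerDim)

theorem part_eq_one_of_length_eq (h : ξ.base.length = n) (i : Fin ξ.base.length) :
    ξ.base.part i = 1 := by
  have h1 : ∑ i : Fin ξ.base.length, 1 = ∑ i, ξ.base.part i := by
    rw [ξ.base.sum_part]; simpa using h
  exact ((Finset.sum_eq_sum_iff_of_le fun i _ => ξ.base.one_le_part i).1 h1 i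
    (Finset.mem_univ i)).symm

/-- All parts are `1`, so `∑ s_i ^ 2 = n` squeezes the centralizer dimension to `n`. -/
theorem stratumDim_eq_of_length_eq (h : ξ.base.length = n) : ξ.stratumDim = 2 * n ^ 2 - n := by
  have h1 := ξ.le_centralizerDim
  have h2 := ξ.centralizerDim_le
  simp only [ξ.part_eq_one_of_length_eq h] at h2
  simp [h] at h2
  have h3 : n ≤ n ^ 2 := Nat.le_self_pow (by simp) n
  rw [stratumDim]
  omega

theorem stratumDim_lt_of_length_ne (h : ξ.base.length ≠ n) : ξ.stratumDim < 2 * n ^ 2 - n := by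
  have h1 := ξ.le_centralizerDim
  have h2 := ξ.base.length_le
  have h3 : n ≤ n ^ 2 := Nat.le_self_pow (by simp) n
  rw [stratumDim]
  omega

theorem stratumDim_le : ξ.stratumDim ≤ 2 * n ^ 2 - n := by
  by_cases h : ξ.base.length = n
  · exact (ξ.stratumDim_eq_of_length_eq h).le
  · exact (ξ.stratumDim_lt_of_length_ne h).le

theorem isEmbeddedSubmanifold_iff {d : ℕ} :
    IsEmbeddedSubmanifold ξ.stratum d ↔ d = ξ.stratumDim :=
  ⟨fun h => h.dim_unique ξ.isEmbeddedSubmanifold_stratum ξ.stratum_nonempty,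
    fun h => h ▸ ξ.isEmbeddedSubmanifold_stratum⟩

theorem isEmbeddedSubmanifold_top_iff :
    IsEmbeddedSubmanifold ξ.stratum (2 * n ^ 2 - n) ↔ ξ.base.length = n := by
  rw [isEmbeddedSubmanifold_iff]
  refine ⟨fun h => ?_, fun h => (ξ.stratumDim_eq_of_length_eq h).symm⟩
  by_contra h'
  exact (ξ.stratumDim_lt_of_length_ne h').ne h.symm

theorem ncard_spectrum {X : Matrix (Fin n) (Fin n) ℂ} (hX : X ∈ ξ.stratum) :
    (spectrum ℂ X).ncard = ξ.base.length := by
  obtain ⟨x, hx, h⟩ := ξ.mem_stratum_iff.1 hX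
  have : spectrum ℂ X = Set.range fun i => (x i : ℂ) * Complex.I :=
    Set.ext fun w => mem_spectrum_of_isSimilarMatrix h
  rw [this, ← Set.image_univ, Set.ncard_image_of_injective _
    fun i j hij => hx (ofReal_mul_I_inj.1 hij), Set.ncard_univ, Nat.card_fin]

theorem hasImaginarySpectrum_of_mem {X : Matrix (Fin n) (Fin n) ℂ} (hX : X ∈ ξ.stratum) :
    HasImaginarySpectrum X := by
  obtain ⟨x, hx, h⟩ := ξ.mem_stratum_iff.1 hX
  intro w hw
  obtain ⟨i, rfl⟩ := (mem_spectrum_of_isSimilarMatrix h).1 hw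
  simp

end RefinedPartition

/-! ### Finiteness of the index set and the generic refined partition -/

instance TuplePartition.finite (n : ℕ) : Finite (TuplePartition n) := by
  let f : TuplePartition n → Σ k : Fin (n + 1), (Fin k → Fin (n + 1)) := fun p =>
    ⟨⟨p.length, Nat.lt_succ_of_le p.length_le⟩,
      fun i => ⟨p.part i, Nat.lt_succ_of_le (p.part_le i)⟩⟩
  refine Finite.of_injective f fun p q h => ?_
  obtain ⟨k, a, _, _, _⟩ := p
  obtain ⟨k', b, _, _, _⟩ := q
  simp only [f, Sigma.mk.injEq, Fin.mk.injEq] at h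
  obtain ⟨rfl, h⟩ := h
  have hab : a = b := funext fun i => congrArg Fin.val (congrFun (eq_of_heq h) i)
  subst hab
  rfl

instance RefinedPartition.finite (n : ℕ) : Finite (RefinedPartition n) := by
  let f : RefinedPartition n → Σ p : TuplePartition n, ∀ i, TuplePartition (p.part i) :=
    fun ξ => ⟨ξ.base, ξ.sub⟩
  refine Finite.of_injective f fun ξ η h => ?_
  obtain ⟨p, s⟩ := ξ
  obtain ⟨q, t⟩ := η
  simp only [f, Sigma.mk.injEq] at h
  obtain ⟨rfl, h⟩ := h
  rw [eq_of_heq h]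

theorem TuplePartition.eq_of_one (p q : TuplePartition 1) : p = q := by
  have h (p : TuplePartition 1) : p.length = 1 := by
    refine le_antisymm p.length_le (Nat.one_le_iff_ne_zero.2 fun h => ?_)
    have := p.sum_part
    have : IsEmpty (Fin p.length) := by rw [h]; infer_instance
    simp_all
  refine ext_of_length ((h p).trans (h q).symm) fun a => ?_
  have h1 := p.part_le a
  have h2 := p.one_le_part a
  have h3 := q.part_le (Fin.cast ((h p).trans (h q).symm) a)
  have h4 := q.one_le_part (Fin.cast ((h p).trans (h q).symm) a)
  omega

theorem RefinedPartition.eq_of_length_eq {n : ℕ} {ξ η : RefinedPartition n}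
    (h : ξ.base.length = n) (h' : η.base.length = n) : ξ = η := by
  have hbase : ξ.base = η.base := TuplePartition.ext_of_length (h.trans h'.symm) fun a => by
    rw [ξ.part_eq_one_of_length_eq h, η.part_eq_one_of_length_eq h']
  have hξ := ξ.part_eq_one_of_length_eq h
  obtain ⟨p, s⟩ := ξ
  obtain ⟨q, t⟩ := η
  obtain rfl : p = q := hbase
  congr 1
  funext i
  have h1 : ∀ (m : ℕ) (_ : m = 1) (a b : TuplePartition m), a = b := by
    rintro m rfl a b
    exact TuplePartition.eq_of_one a b
  exact h1 _ (hξ i) _ _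

/-- The partition with all parts equal to one. -/
def TuplePartition.ones (n : ℕ) : TuplePartition n where
  length := n
  part := fun _ => 1
  antitone_part := fun _ _ _ => le_rfl
  one_le_part := fun _ => le_rfl
  sum_part := by simp

/-- The refined partition of the generic stratum. -/
def RefinedPartition.generic (n : ℕ) : RefinedPartition n where
  base := TuplePartition.ones n
  sub := fun _ => TuplePartition.ones 1

/-! ### Jordan normal form and exhaustion by the strata -/

section JordanForm

open Polynomial

/-- Over `ℂ`, `p` is associated to some `X - z`. The coordinates are the Taylor coefficients at `z`
of order below `e`, and `X = z + (X - z)` acts on them as `z` plus a shift. -/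
theorem exists_quotient_equiv_jordanBlock {p : ℂ[X]} (hp : Irreducible p) (e : ℕ) :
    ∃ (z : ℂ) (E : (ℂ[X] ⧸ (Submodule.span ℂ[X] {p ^ e})) ≃ₗ[ℂ] (Fin e → ℂ)),
      ∀ q, E ((X : ℂ[X]) • q) = jordanBlockMatrix e z *ᵥ E q := by
  obtain ⟨z, hz⟩ := IsAlgClosed.exists_root p (degree_pos_of_irreducible hp).ne'
  have hassoc : Associated (X - C z) p :=
    (irreducible_X_sub_C z).associated_of_dvd hp (dvd_iff_isRoot.2 hz)
  have hspan : Submodule.span ℂ[X] {p ^ e} = Ideal.span {(X - C z) ^ e} :=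
    (Ideal.span_singleton_eq_span_singleton.2 (hassoc.pow_pow (n := e))).symm
  rw [hspan]
  -- The order `e - 1 - j` is reversed so that the shift puts the ones on the superdiagonal.
  let φ : ℂ[X] →ₗ[ℂ] (Fin e → ℂ) :=
    LinearMap.pi fun j => (lcoeff ℂ (e - 1 - j)).comp (taylor z : ℂ[X] →ₗ[ℂ] ℂ[X])
  have hφ (q : ℂ[X]) (j : Fin e) : φ q j = (taylor z q).coeff (e - 1 - j) := rfl
  have hker : (Ideal.span {(X - C z) ^ e} : Submodule ℂ[X] ℂ[X]).restrictScalars ℂ =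
      LinearMap.ker φ := by
    ext q
    rw [Submodule.restrictScalars_mem, Ideal.mem_span_singleton, LinearMap.mem_ker]
    have h1 : (X - C z) ^ e ∣ q ↔ X ^ e ∣ taylor z q := by
      have h2 (q : ℂ[X]) : taylorEquiv z q = taylor z q := rfl
      rw [← map_dvd_iff (taylorEquiv z), map_pow, h2, h2, map_sub, taylor_X, taylor_C,
        add_sub_cancel_right]
    rw [h1, X_pow_dvd_iff]
    constructor
    · intro h
      funext j
      rw [hφ, h _ (by omega)]
      rfl
    · intro h d hd
      have := congrFun h ⟨e - 1 - d, by omega⟩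
      rw [hφ, show e - 1 - (e - 1 - d) = d by omega] at this
      exact this
  have hsurj : Function.Surjective φ := by
    intro v
    refine ⟨(taylorEquiv z).symm (∑ j : Fin e, C (v j) * X ^ (e - 1 - (j : ℕ))), ?_⟩
    funext j
    have h1 : taylor z ((taylorEquiv z).symm (∑ j : Fin e, C (v j) * X ^ (e - 1 - (j : ℕ)))) =
        ∑ j : Fin e, C (v j) * X ^ (e - 1 - (j : ℕ)) := (taylorEquiv z).apply_symm_apply _
    rw [hφ, h1, finsetSum_coeff, Finset.sum_eq_single j]
    · simp
    · intro k _ hk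
      rw [coeff_C_mul_X_pow, if_neg]
      intro h
      exact hk (Fin.ext (by omega))
    · simp
  let E := ((Submodule.Quotient.restrictScalarsEquiv ℂ
    (Ideal.span {(X - C z) ^ e} : Submodule ℂ[X] ℂ[X])).symm.trans
    (Submodule.quotEquivOfEq _ _ hker)).trans (φ.quotKerEquivOfSurjective hsurj)
  have hE (q : ℂ[X]) : E (Submodule.Quotient.mk q) = φ q := rfl
  refine ⟨z, E, fun q => ?_⟩
  obtain ⟨q, rfl⟩ := Submodule.Quotient.mk_surjective _ q
  rw [← Submodule.Quotient.mk_smul, hE, hE]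
  funext j
  rw [hφ, smul_eq_mul, taylor_mul, taylor_X, add_mul, coeff_add, coeff_C_mul]
  have hJ : (jordanBlockMatrix e z *ᵥ φ q) j =
      (if h : (j : ℕ) + 1 < e then φ q ⟨j + 1, h⟩ else 0) + z * φ q j := by
    have hJ' : jordanBlockMatrix e z = (jordanBlockMatrix e z - z • 1) ^ 1 + z • 1 := by simp
    rw [hJ', add_mulVec, smul_mulVec, one_mulVec, Pi.add_apply, Pi.smul_apply, smul_eq_mul]
    congr 1
    simp only [mulVec, dotProduct, jordanBlockMatrix_sub_smul_pow_apply, ite_mul, one_mul, zero_mul]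
    split_ifs with h
    · rw [Finset.sum_eq_single ⟨j + 1, h⟩]
      · simp
      · intro l _ hl
        rw [if_neg]
        intro h'
        exact hl (Fin.ext h'.symm)
      · simp
    · refine Finset.sum_eq_zero fun l _ => ?_
      rw [if_neg]
      omega
  rw [hJ]
  congr 1
  split_ifs with h
  · rw [hφ, show e - 1 - (j : ℕ) = (e - 1 - ((j : ℕ) + 1)) + 1 by omega, coeff_X_mul]
  · rw [show e - 1 - (j : ℕ) = 0 by omega, coeff_X_mul_zero]

/-- Let `X` act on `ℂ^n` through `A`; this is a torsion `ℂ[X]`-module, hence a sum of cyclic modules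
of prime power order. Exponents `0`, thus empty blocks, are not excluded. -/
theorem exists_isSimilarMatrix_jordanBlocks {n : ℕ} (A : Matrix (Fin n) (Fin n) ℂ) :
    ∃ (ι : Type) (_ : Fintype ι) (_ : DecidableEq ι) (z : ι → ℂ) (s : ι → ℕ),
      IsSimilarMatrix A (blockDiagonal' fun i => jordanBlockMatrix (s i) (z i)) := by
  classical
  let f : (Fin n → ℂ) →ₗ[ℂ] (Fin n → ℂ) := Matrix.toLin' A
  obtain ⟨ι, _, p, hp, e, ⟨l⟩⟩ := Module.equiv_directSum_of_isTorsion
    (R := ℂ[X]) (M := Module.AEval' f)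
    (Module.AEval.isTorsion_of_finiteDimensional ℂ (Fin n → ℂ) f)
  choose z E hE using fun i => exists_quotient_equiv_jordanBlock (hp i) (e i)
  refine ⟨ι, inferInstance, inferInstance, z, e, ?_⟩
  let L : Module.AEval' f ≃ₗ[ℂ[X]] ∀ i, ℂ[X] ⧸ (Submodule.span ℂ[X] {p i ^ e i}) :=
    l.trans (DirectSum.linearEquivFunOnFintype ℂ[X] ι _)
  let Λ : (Fin n → ℂ) ≃ₗ[ℂ] ((Σ i, Fin (e i)) → ℂ) :=
    (((Module.AEval'.of f).trans (L.restrictScalars ℂ)).trans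
      (LinearEquiv.piCongrRight E)).trans
      (LinearEquiv.piCurry ℂ (fun (i : ι) (_ : Fin (e i)) => ℂ)).symm
  have hΛ (v : Fin n → ℂ) (i : ι) (a : Fin (e i)) :
      Λ v ⟨i, a⟩ = E i (L (Module.AEval'.of f v) i) a := rfl
  have hint (v : Fin n → ℂ) :
      Λ (f v) = (blockDiagonal' fun i => jordanBlockMatrix (e i) (z i)) *ᵥ Λ v := by
    funext ⟨i, a⟩
    rw [hΛ, ← Module.AEval'.X_smul_of, map_smul, Pi.smul_apply, hE]
    simp only [mulVec, dotProduct, Fintype.sum_sigma]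
    rw [Finset.sum_eq_single i]
    · simp [hΛ]
    · intro j _ hj
      exact Finset.sum_eq_zero fun b _ => by rw [blockDiagonal'_apply_ne _ _ _ hj.symm, zero_mul]
    · simp
  refine ⟨LinearMap.toMatrix' Λ.symm.toLinearMap, LinearMap.toMatrix' Λ.toLinearMap, ?_, ?_, ?_⟩
  · rw [← LinearMap.toMatrix'_comp, LinearEquiv.symm_comp, LinearMap.toMatrix'_id]
  · rw [← LinearMap.toMatrix'_comp, LinearEquiv.comp_symm, LinearMap.toMatrix'_id]
  · apply Matrix.toLin'.injective
    rw [Matrix.toLin'_mul, Matrix.toLin'_mul, Matrix.toLin'_toMatrix', Matrix.toLin'_toMatrix']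
    refine LinearMap.ext fun v => ?_
    simp only [LinearMap.comp_apply, Matrix.toLin'_apply, LinearEquiv.coe_coe]
    rw [← hint, LinearEquiv.symm_apply_apply]
    rfl

/-- Discards the empty blocks, since parts of a partition must be positive. -/
theorem isSimilarMatrix_blockDiagonal'_pos {ι : Type*} [Fintype ι] [DecidableEq ι] (s : ι → ℕ)
    (A : ∀ i, Matrix (Fin (s i)) (Fin (s i)) ℂ) :
    IsSimilarMatrix (blockDiagonal' fun i : {i // 1 ≤ s i} => A i) (blockDiagonal' A) := by
  let e : (Σ i : {i // 1 ≤ s i}, Fin (s i)) ≃ Σ i, Fin (s i) :=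
    { toFun := fun a => ⟨a.1, a.2⟩
      invFun := fun a => ⟨⟨a.1, a.2.pos⟩, a.2⟩
      left_inv := fun a => rfl
      right_inv := fun a => rfl }
  convert IsSimilarMatrix.of_equiv e (blockDiagonal' A) using 1
  ext ⟨i, a⟩ ⟨j, b⟩
  by_cases hij : i = j
  · subst hij; simp [e]
  · rw [blockDiagonal'_apply_ne _ _ _ hij, Matrix.submatrix_apply]
    exact (blockDiagonal'_apply_ne _ _ _ fun h => hij (Subtype.ext h)).symm

end JordanForm

theorem TuplePartition.exists_of_family {ι : Type*} [Fintype ι] {s : ι → ℕ} (hs : ∀ i, 1 ≤ s i)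
    {m : ℕ} (hm : ∑ i, s i = m) :
    ∃ (p : TuplePartition m) (e : Fin p.length ≃ ι), ∀ i, p.part i = s (e i) := by
  -- Sorting increasingly in the order dual gives the decreasing tuple.
  let f : Fin (Fintype.card ι) → ℕᵒᵈ := fun i => OrderDual.toDual (s ((Fintype.equivFin ι).symm i))
  let e : Fin (Fintype.card ι) ≃ ι := (Tuple.sort f).trans (Fintype.equivFin ι).symm
  exact ⟨⟨Fintype.card ι, fun i => s (e i), fun i j hij => Tuple.monotone_sort f hij,
    fun i => hs _, (Equiv.sum_comp e s).trans hm⟩, e, fun i => rfl⟩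

theorem TuplePartition.exists_isSimilarMatrix {ι : Type*} [Fintype ι] [DecidableEq ι] {s : ι → ℕ}
    (hs : ∀ i, 1 ≤ s i) {m : ℕ} (hm : ∑ i, s i = m) :
    ∃ p : TuplePartition m, ∀ z, IsSimilarMatrix (p.jordanMatrix z)
      (blockDiagonal' fun i => jordanBlockMatrix (s i) z) := by
  obtain ⟨p, e, he⟩ := TuplePartition.exists_of_family hs hm
  refine ⟨p, fun z => (p.isSimilarMatrix_jordanMatrix z).trans ?_⟩
  refine IsSimilarMatrix.trans (IsSimilarMatrix.blockDiagonal fun i => ?_)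
    (IsSimilarMatrix.blockDiagonal_comp_equiv e fun i => jordanBlockMatrix (s i) z)
  rw [he]
  exact IsSimilarMatrix.refl _

/-- The blocks are grouped by the fibres of `t`: the fibre sums, sorted, form the base partition,
and the sizes within each fibre, sorted, form the subpartitions. Indexing by the range of `t` makes
the new parameter injective. -/
theorem RefinedPartition.exists_isSimilarMatrix {ι : Type} [Fintype ι] [DecidableEq ι] {s : ι → ℕ}
    (hs : ∀ i, 1 ≤ s i) {n : ℕ} (hn : ∑ i, s i = n) (t : ι → ℝ) :
    ∃ (ξ : RefinedPartition n) (x : Fin ξ.base.length → ℝ), Function.Injective x ∧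
      IsSimilarMatrix (ξ.jordanMatrix x)
        (blockDiagonal' fun i => jordanBlockMatrix (s i) ((t i : ℂ) * Complex.I)) := by
  classical
  let f : ι → Set.range t := Set.rangeFactorization t
  have : Fintype (Set.range t) := Fintype.ofFinite _
  let m : Set.range t → ℕ := fun κ => ∑ i : {i // f i = κ}, s i
  have hm (κ) : 1 ≤ m κ := by
    obtain ⟨_, i, rfl⟩ := κ
    exact (hs i).trans (Finset.single_le_sum (f := fun j : {j // f j = f i} => s j)
      (fun _ _ => Nat.zero_le _) (Finset.mem_univ ⟨i, rfl⟩))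
  have hmsum : ∑ κ, m κ = n := by
    rw [← hn, ← Equiv.sum_comp (Equiv.sigmaFiberEquiv f), Fintype.sum_sigma]
    rfl
  obtain ⟨p, e, he⟩ := TuplePartition.exists_of_family hm hmsum
  have hsub (i : Fin p.length) : ∃ q : TuplePartition (p.part i), ∀ z,
      IsSimilarMatrix (q.jordanMatrix z)
        (blockDiagonal' fun j : {j // f j = e i} => jordanBlockMatrix (s j) z) := by
    rw [he]
    exact TuplePartition.exists_isSimilarMatrix (fun j => hs _) rfl
  choose q hq using hsub
  refine ⟨⟨p, q⟩, fun i => (e i).1, Subtype.val_injective.comp e.injective, ?_⟩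
  refine (RefinedPartition.isSimilarMatrix_jordanMatrix ⟨p, q⟩ _).trans ?_
  refine (IsSimilarMatrix.blockDiagonal fun i => hq i _).trans ?_
  refine (IsSimilarMatrix.blockDiagonal_comp_equiv e fun κ : Set.range t =>
    blockDiagonal' fun j : {j // f j = κ} =>
      jordanBlockMatrix (s j) ((κ.1 : ℂ) * Complex.I)).trans ?_
  have heq : (fun κ : Set.range t => blockDiagonal' fun j : {j // f j = κ} =>
      jordanBlockMatrix (s j) ((κ.1 : ℂ) * Complex.I)) =
      fun κ : Set.range t => blockDiagonal' fun j : {j // f j = κ} =>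
        jordanBlockMatrix (s j) ((t j : ℂ) * Complex.I) := by
    funext κ
    congr 1
    funext j
    rw [← show t j = κ.1 from congrArg Subtype.val j.2]
  rw [heq]
  refine (IsSimilarMatrix.blockDiagonal_sigma fun a : Σ κ, {j // f j = κ} =>
    jordanBlockMatrix (s a.2) ((t a.2 : ℂ) * Complex.I)).symm.trans ?_
  exact IsSimilarMatrix.blockDiagonal_comp_equiv (Equiv.sigmaFiberEquiv f) fun i =>
    jordanBlockMatrix (s i) ((t i : ℂ) * Complex.I)

theorem HasImaginarySpectrum.exists_mem_stratum {n : ℕ} {X : Matrix (Fin n) (Fin n) ℂ}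
    (hX : HasImaginarySpectrum X) : ∃ ξ : RefinedPartition n, X ∈ ξ.stratum := by
  obtain ⟨ι, _, _, z, s, h⟩ := exists_isSimilarMatrix_jordanBlocks X
  replace h := h.trans (isSimilarMatrix_blockDiagonal'_pos s _).symm
  have hz (i : {i // 1 ≤ s i}) : (((z i).im : ℝ) : ℂ) * Complex.I = z i := by
    have hre : (z i).re = 0 := by
      apply hX
      rw [RefinedPartition.mem_spectrum_iff_det, (h.sub_smul_one _).det_eq,
        det_blockDiagonal'_sub_smul]
      refine Finset.prod_eq_zero (Finset.mem_univ i) ?_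
      rw [det_jordanBlockMatrix_sub_smul, sub_self, zero_pow (Nat.one_le_iff_ne_zero.1 i.2)]
    apply Complex.ext <;> simp [hre]
  -- An invertible rectangular matrix has index types of equal cardinality.
  have hn : ∑ i : {i // 1 ≤ s i}, s i = n := by
    obtain ⟨P, Q, hPQ, hQP, -⟩ := h
    simpa using Fintype.card_congr (Matrix.indexEquivOfInv hQP hPQ)
  obtain ⟨ξ, x, hx, hsim⟩ := RefinedPartition.exists_isSimilarMatrix
    (s := fun i : {i // 1 ≤ s i} => s i) (fun i => i.2) hn fun i => (z i).im
  simp only [hz] at hsim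
  exact ⟨ξ, ξ.mem_stratum_iff.2 ⟨x, hx, h.trans hsim.symm⟩⟩

theorem theorem7p3 (n : ℕ) :
    Finite (RefinedPartition n) ∧
    {X : Matrix (Fin n) (Fin n) ℂ | HasImaginarySpectrum X} =
      ⋃ ξ : RefinedPartition n, ξ.stratum ∧
    (∀ ξ η : RefinedPartition n, ξ.stratum = η.stratum ∨ Disjoint ξ.stratum η.stratum) ∧
    (∀ ξ : RefinedPartition n, ξ.stratum.Nonempty ∧ IsConjugacyInvariant ξ.stratum ∧
      ∃ d : ℕ, d ≤ 2 * n ^ 2 - n ∧ IsEmbeddedSubmanifold ξ.stratum d) ∧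
    (∃! ξ : RefinedPartition n, IsEmbeddedSubmanifold ξ.stratum (2 * n ^ 2 - n)) ∧
    (∀ ξ : RefinedPartition n, IsEmbeddedSubmanifold ξ.stratum (2 * n ^ 2 - n) →
      ξ.stratum = {X : Matrix (Fin n) (Fin n) ℂ |
        HasImaginarySpectrum X ∧ (spectrum ℂ X).ncard = n}) := by
  refine ⟨inferInstance, ?_, RefinedPartition.stratum_eq_or_disjoint, fun ξ =>
    ⟨ξ.stratum_nonempty, ξ.isConjugacyInvariant_stratum, ξ.stratumDim, ξ.stratumDim_le,
      ξ.isEmbeddedSubmanifold_stratum⟩, ?_, fun ξ hξ => ?_⟩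
  · ext X
    rw [Set.mem_iUnion]
    exact ⟨fun h => HasImaginarySpectrum.exists_mem_stratum h,
      fun ⟨ξ, h⟩ => ξ.hasImaginarySpectrum_of_mem h⟩
  · refine ⟨RefinedPartition.generic n,
      (RefinedPartition.isEmbeddedSubmanifold_top_iff _).2 rfl, fun ξ hξ => ?_⟩
    exact RefinedPartition.eq_of_length_eq (ξ.isEmbeddedSubmanifold_top_iff.1 hξ) rfl
  · rw [RefinedPartition.isEmbeddedSubmanifold_top_iff] at hξ
    ext X
    constructor
    · intro h
      exact ⟨ξ.hasImaginarySpectrum_of_mem h, (ξ.ncard_spectrum h).trans hξ⟩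
    -- The matrix lies in some stratum `η`, whose length is the number of eigenvalues, here `n`;
    -- only one refined partition has length `n`.
    · rintro ⟨h, hcard⟩
      obtain ⟨η, hη⟩ := HasImaginarySpectrum.exists_mem_stratum h
      rw [η.ncard_spectrum hη] at hcard
      rwa [RefinedPartition.eq_of_length_eq hξ hcard]
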